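/- Consider an $M|G|1$ queue with two priority classes (premium over ordinary) under the preemptive-resume discipline, with service in order of arrival within each class: customers arrive in a Poisson process of rate $\lambda>0$, their service times are i.i.d. and nonnegative with mean $1/\mu$ ($\mu>0$) and finite second moment $K/\mu^2$, the load $\rho=\lambda/\mu$ satisfies $\rho<1$, and each customer joins the premium class with probability $\phi\in[0,1]$, independently of everything else. For each state $\phi$ let $E[W]$ be the steady-state expected time that a customer spends in the system without being served, i.e. the limit, as $n\to\infty$, of the expected waiting time of the $n$-th customer when the system starts empty. Then this limit exists for every $\phi\in[0,1]$ and equals $$E[W]=\frac{\rho\left(K-2\phi\rho+(2-K)\phi(1-\phi(1-\rho))\right)}{2\mu(1-\rho)(1-\phi\rho)}.$$ Call $\phi\in[0,1]$ socially optimal if it minimizes $E[W]$ over $[0,1]$, and let $\phi^*=\frac{1-\sqrt{1-\rho}}{\rho}$. Then: - if $K<2$, the socially optimal states are exactly $\phi=0$ and $\phi=1$; - if $K=2$, every $\phi\in[0,1]$ is socially optimal; - if $K>2$, the unique socially optimal state is $\phi=\phi^*$. -/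

import Mathlib

open MeasureTheory ProbabilityTheory Filter Topology unitInterval
open scoped ENNReal

/-! # A two-class M/G/1 queue with preemptive-resume priorities

Customers `0, 1, 2, …` arrive one after the other; the server is idle and the system empty when
customer `0` arrives. A customer is described by a triple: the time that elapses from his arrival
until the next arrival, his service requirement, and his class (`true` for premium, `false` for
ordinary). The server always works at unit rate on the customer present that is first in the
priority order: premium before ordinary, and in order of arrival within a class. A premium arrival
thus preempts an ordinary customer in service, whose service is resumed later where it stopped. -/

namespace PRQueue

/-- A realization of the input of the queue: for each customer the time to the next arrival, the
service requirement, and the class. -/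
abbrev Input : Type := ℕ → ℝ × ℝ × Bool

/-- Time between the arrivals of customers `n` and `n + 1` (called period `n` below). -/
def gap (ω : Input) (n : ℕ) : ℝ := (ω n).1

/-- Service requirement of customer `n`. -/
def service (ω : Input) (n : ℕ) : ℝ := (ω n).2.1

/-- Class of customer `n`: `true` for premium, `false` for ordinary. -/
def premium (ω : Input) (n : ℕ) : Bool := (ω n).2.2

/-- Customer `j` has priority over customer `i`. -/
abbrev Precedes (ω : Input) (j i : ℕ) : Prop :=
  (premium ω j = true ∧ premium ω i = false) ∨ (premium ω j = premium ω i ∧ j < i)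

/-- If `r j` is the remaining service of customer `j` at the start of period `n`, this is the total
remaining service of the customers arrived so far that have priority over customer `i`. -/
def workAhead (ω : Input) (n : ℕ) (r : ℕ → ℝ) (i : ℕ) : ℝ :=
  ∑ j ∈ Finset.range (n + 1) with Precedes ω j i, r j

/-- Remaining service of customer `j` immediately after the arrival of customer `n` (the start of
period `n`); it is zero for customers that have not arrived yet. During a period, a customer is
served exactly in the time that is left over by the customers who have priority over him. -/
noncomputable def residual (ω : Input) : ℕ → ℕ → ℝ
  | 0 => fun j => if j = 0 then service ω 0 else 0
  | n + 1 => fun j =>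
      if j = n + 1 then service ω (n + 1)
      else residual ω n j
        - min (residual ω n j) (max 0 (gap ω n - workAhead ω n (residual ω n) j))

/-- Work that has priority over customer `i` at the start of period `n`. -/
noncomputable def ahead (ω : Input) (n i : ℕ) : ℝ := workAhead ω n (residual ω n) i

/-- Customer `i` is in the system at the start of period `n`: he has arrived, and in no period since
his arrival was there enough time to complete the work ahead of him and his own service. -/
def InSystem (ω : Input) (i n : ℕ) : Prop :=
  i ≤ n ∧ ∀ m, i ≤ m → m < n → gap ω m < ahead ω m i + residual ω m i

/-- Waiting time of customer `i`: the total time he spends in the system without being served, before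
his service starts and while it is interrupted. In a period at whose start he is in the system, he is
not served as long as the work ahead of him is not completed. -/
noncomputable def wait (ω : Input) (i : ℕ) : ℝ≥0∞ :=
  ∑' n, Set.indicator {n | InSystem ω i n} (fun n => ENNReal.ofReal (min (gap ω n) (ahead ω n i))) n

/-- Law of the input: Poisson arrivals of rate `lam` (independent exponential interarrival times),
independent service requirements of law `G`, and each customer premium with probability `φ`
independently of everything else. -/
noncomputable def inputLaw (lam : ℝ) (G : Measure ℝ) (φ : I) : Measure Input :=
  Measure.infinitePi fun _ : ℕ =>
    (expMeasure lam).prod (G.prod (bernoulliMeasure true false φ))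

/-- Expected waiting time of customer `n` when a fraction `φ` of the customers joins the premium
class. -/
noncomputable def expectedWait (lam : ℝ) (G : Measure ℝ) (φ : I) (n : ℕ) : ℝ≥0∞ :=
  ∫⁻ ω, wait ω n ∂(inputLaw lam G φ)

/-- Steady-state expected waiting time `E[W]` of a customer in state `φ`, as the upper limit of the
expected waiting time of customer `n` (so that it is defined whether or not the limit exists). -/
noncomputable def meanWait (lam : ℝ) (G : Measure ℝ) (φ : I) : ℝ≥0∞ :=
  limsup (expectedWait lam G φ) atTop

/-- The socially optimal states: the `φ ∈ [0, 1]` that minimize `E[W]` over `[0, 1]`. -/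
def optimalStates (lam : ℝ) (G : Measure ℝ) : Set ℝ :=
  {x | ∃ φ : I, (φ : ℝ) = x ∧ ∀ ψ : I, meanWait lam G φ ≤ meanWait lam G ψ}

end PRQueue

/-! The proof reduces the queue to two one-dimensional processes and takes means.

Work found on arrival. A set of customers closed under priority is served as if the others were
absent. So the work that counts for class `c` (all work for an ordinary customer, premium work for a
premium one) obeys Lindley's recursion `D ↦ max 0 (D + B - A)` from `0`. For `A` exponential of rate
`lam`, integration by parts gives `E[(r - A)₊^(k+1)] + (k+1)/lam * E[(r - A)^k; A < r] = r^(k+1)`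
(`overshoot_succ_add`), hence exact balances between the moments of consecutive terms. Started at
`0`, the recursion is stochastically increasing, so the second-moment balance bounds the means. If
`B` has a third moment, the third-moment balance bounds the second moments; these then converge, and
the limit of the second-moment balance is the Pollaczek–Khinchine value. In general, truncating `B`
gives matching lower bounds (`tendsto_powMoment_lindleyLaw`).

Sojourn. While customer `i` is present, his backlog (work ahead plus own remaining service) falls at
unit rate and jumps by the service of each premium arrival if he is ordinary. Let `b` be the mean
jump. From backlog `r`, one period removes `(1/lam - b) * P(A < r)` on average and lasts `E[min(A,
r)] = P(A < r) / lam` for him. Summing over periods, the mean sojourn is the mean initial backlog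
divided by `1 - lam * b` (`wait_balance`). No mass is lost at infinity, because a quadratic Lyapunov
function makes the mean backlogs summable. Subtracting the service gives the mean wait.

Optimization. With `b = 0` for premium and `b = φ/mu` for ordinary customers, averaging gives `E[W]`
as a positive constant times `K + (2 - K) * h φ`, where `h φ = (1 - rho) φ (1 - φ) / (1 - φ rho)`.
This `h` is nonnegative on `[0, 1]`, vanishes exactly at `0` and `1`, and by completing a square has
its unique maximum at `φ*`; the sign of `2 - K` decides. -/

namespace PRQueue

/-! ### Truncated moments of the exponential law -/

/-- The truncated moment `E[(r - A)^k; A < r]` of an exponential variable `A` of rate `lam`. -/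
noncomputable def overshoot (lam : ℝ) (k : ℕ) (r : ℝ) : ℝ≥0∞ :=
  ∫⁻ a, (if a < r then ENNReal.ofReal ((r - a) ^ k) else 0) ∂(expMeasure lam)

lemma lintegral_expMeasure (lam : ℝ) {f : ℝ → ℝ≥0∞} (hf : Measurable f) :
    ∫⁻ a, f a ∂(expMeasure lam)
      = ∫⁻ a in Set.Ici 0, ENNReal.ofReal (lam * Real.exp (-(lam * a))) * f a := by
  have h : expMeasure lam = volume.withDensity (exponentialPDF lam) := rfl
  have hm : Measurable (exponentialPDF lam) :=
    (measurable_exponentialPDFReal lam).ennreal_ofReal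
  rw [h, lintegral_withDensity_eq_lintegral_mul _ hm hf, ← lintegral_indicator measurableSet_Ici]
  refine lintegral_congr fun a => ?_
  by_cases ha : 0 ≤ a
  · rw [Set.indicator_of_mem (by exact ha), Pi.mul_apply, exponentialPDF_of_nonneg ha]
  · rw [Set.indicator_of_notMem (by exact ha), Pi.mul_apply,
      exponentialPDF_of_neg (not_le.mp ha), zero_mul]

lemma ae_nonneg_expMeasure (lam : ℝ) : ∀ᵐ a ∂(expMeasure lam), 0 ≤ a := by
  have hs : MeasurableSet {a : ℝ | ¬ 0 ≤ a} := by
    simp only [not_le]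
    exact measurableSet_Iio
  rw [ae_iff, ← lintegral_indicator_one hs,
    lintegral_expMeasure lam (measurable_one.indicator hs)]
  rw [setLIntegral_congr_fun (g := fun _ => 0) measurableSet_Ici]
  · simp
  · intro a ha
    have : a ∉ {a : ℝ | ¬ 0 ≤ a} := fun h => h ha
    simp only [Set.indicator_of_notMem this, mul_zero]

lemma measurable_overshoot_integrand (k : ℕ) :
    Measurable fun p : ℝ × ℝ => if p.2 < p.1 then ENNReal.ofReal ((p.1 - p.2) ^ k) else 0 :=
  Measurable.ite (measurableSet_lt measurable_snd measurable_fst) (by fun_prop) measurable_const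

lemma measurable_overshoot {lam : ℝ} (hlam : 0 < lam) (k : ℕ) :
    Measurable (overshoot lam k) := by
  have := isProbabilityMeasure_expMeasure hlam
  exact (measurable_overshoot_integrand k).lintegral_prod_right'

lemma overshoot_eq_ofReal_integral {lam : ℝ} (hlam : 0 < lam) (k : ℕ) {r : ℝ} (hr : 0 ≤ r) :
    overshoot lam k r
      = ENNReal.ofReal (∫ a in (0 : ℝ)..r, lam * Real.exp (-(lam * a)) * (r - a) ^ k) := by
  have hmeas : Measurable fun a : ℝ => if a < r then ENNReal.ofReal ((r - a) ^ k) else 0 :=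
    (measurable_overshoot_integrand k).comp (measurable_const.prodMk measurable_id)
  rw [overshoot, lintegral_expMeasure lam hmeas, intervalIntegral.integral_of_le hr,
    ofReal_integral_eq_lintegral_ofReal]
  · rw [← restrict_Ico_eq_restrict_Ioc, ← lintegral_indicator measurableSet_Ico,
      ← lintegral_indicator measurableSet_Ici]
    refine lintegral_congr fun a => ?_
    simp only [Set.indicator_apply, Set.mem_Ici, Set.mem_Ico]
    by_cases h0 : 0 ≤ a <;> by_cases h1 : a < r <;> simp only [h0, h1, if_true, if_false, and_self,
      and_true, and_false, mul_zero]
    rw [← ENNReal.ofReal_mul (by positivity)]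
  · exact (Continuous.integrableOn_Icc (by fun_prop)).mono_set Set.Ioc_subset_Icc_self
  · refine (ae_restrict_iff' measurableSet_Ioc).mpr (ae_of_all _ fun a ha => ?_)
    have : 0 ≤ r - a := by linarith [ha.2]
    simp only [Pi.zero_apply]
    positivity

lemma integral_exp_mul_nonneg {lam : ℝ} (hlam : 0 < lam) (k : ℕ) {r : ℝ} (hr : 0 ≤ r) :
    0 ≤ ∫ a in (0 : ℝ)..r, lam * Real.exp (-(lam * a)) * (r - a) ^ k := by
  refine intervalIntegral.integral_nonneg hr fun a ha => ?_
  have : 0 ≤ r - a := by linarith [ha.2]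
  positivity

/-- Integration by parts: the combined integrand is the derivative of `-(r - a)^(k+1) * exp(-lam
a)`, which vanishes at `a = r`. Every moment balance below comes from this identity. It is kept as a
sum because subtraction in `ℝ≥0∞` is truncated. -/
lemma overshoot_succ_add {lam : ℝ} (hlam : 0 < lam) (k : ℕ) {r : ℝ} (hr : 0 ≤ r) :
    overshoot lam (k + 1) r + ENNReal.ofReal ((k + 1) / lam) * overshoot lam k r
      = ENNReal.ofReal (r ^ (k + 1)) := by
  rw [overshoot_eq_ofReal_integral hlam _ hr, overshoot_eq_ofReal_integral hlam _ hr,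
    ← ENNReal.ofReal_mul (by positivity),
    ← ENNReal.ofReal_add (integral_exp_mul_nonneg hlam _ hr)
      (mul_nonneg (by positivity) (integral_exp_mul_nonneg hlam _ hr)),
    ← intervalIntegral.integral_const_mul, ← intervalIntegral.integral_add
      (Continuous.intervalIntegrable (by fun_prop) _ _)
      (Continuous.intervalIntegrable (by fun_prop) _ _)]
  congr 1
  have hderiv : ∀ x ∈ Set.uIcc 0 r, HasDerivAt
      (fun a => -((r - a) ^ (k + 1) * Real.exp (-(lam * a))))
      (lam * Real.exp (-(lam * x)) * (r - x) ^ (k + 1)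
        + (k + 1) / lam * (lam * Real.exp (-(lam * x)) * (r - x) ^ k)) x := by
    intro x _
    have h1 : HasDerivAt (fun a : ℝ => (r - a) ^ (k + 1)) ((k + 1) * (r - x) ^ k * (-1)) x := by
      have := ((hasDerivAt_id x).const_sub r).fun_pow (k + 1)
      simpa using this
    have h2 : HasDerivAt (fun a : ℝ => Real.exp (-(lam * a)))
        (Real.exp (-(lam * x)) * (-(lam * 1))) x :=
      (((hasDerivAt_id x).const_mul lam).neg).exp
    have h3 := (h1.mul h2).neg
    refine h3.congr_deriv ?_
    simp only [pow_succ]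
    field_simp
    ring
  rw [intervalIntegral.integral_eq_sub_of_hasDerivAt hderiv
    (Continuous.intervalIntegrable (by fun_prop) _ _)]
  simp

lemma overshoot_ne_top {lam : ℝ} (hlam : 0 < lam) (k : ℕ) {r : ℝ} (hr : 0 ≤ r) :
    overshoot lam k r ≠ ∞ := by
  rw [overshoot_eq_ofReal_integral hlam _ hr]
  exact ENNReal.ofReal_ne_top

/-- The expected length of a busy interval within one period: `E[min(A, r)] = P(A < r) / lam`. -/
lemma lintegral_min_expMeasure {lam : ℝ} (hlam : 0 < lam) {r : ℝ} (hr : 0 ≤ r) :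
    ∫⁻ a, ENNReal.ofReal (min a r) ∂(expMeasure lam)
      = ENNReal.ofReal (1 / lam) * overshoot lam 0 r := by
  have := isProbabilityMeasure_expMeasure hlam
  have h := overshoot_succ_add hlam 0 hr
  -- Pointwise `(r - a)₊ + min a r = r`; comparison with `overshoot_succ_add` at `k = 0` lets the
  -- finite first term cancel.
  have hsum : overshoot lam 1 r + ∫⁻ a, ENNReal.ofReal (min a r) ∂(expMeasure lam)
      = ENNReal.ofReal r := by
    rw [overshoot, ← lintegral_add_right _ (by fun_prop)]
    have : ∀ᵐ a ∂(expMeasure lam), (if a < r then ENNReal.ofReal ((r - a) ^ 1) else 0)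
        + ENNReal.ofReal (min a r) = ENNReal.ofReal r := by
      filter_upwards [ae_nonneg_expMeasure lam] with a ha
      split_ifs with h1
      · rw [min_eq_left h1.le, pow_one, ← ENNReal.ofReal_add (by linarith) ha]
        congr 1
        ring
      · rw [min_eq_right (not_lt.mp h1), zero_add]
    rw [lintegral_congr_ae this]
    simp
  simp only [Nat.cast_zero, zero_add, pow_one] at h
  rw [← h] at hsum
  exact (ENNReal.add_right_inj (overshoot_ne_top hlam 1 hr)).mp hsum

/-! ### Lindley's recursion and its moment balances -/

/-- Moments of the positive part of a real random variable of law `ν`. -/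
noncomputable def powMoment (ν : Measure ℝ) (k : ℕ) : ℝ≥0∞ :=
  ∫⁻ x, ENNReal.ofReal x ^ k ∂ν

/-- Law of the `n`-th term of Lindley's recursion `D ↦ max 0 (D + B - A)` started at `0`, with `B` of
law `ν` and `A` exponential of rate `lam`. -/
noncomputable def lindleyLaw (lam : ℝ) (ν : Measure ℝ) : ℕ → Measure ℝ
  | 0 => Measure.dirac 0
  | n + 1 => (((lindleyLaw lam ν n).prod ν).prod (expMeasure lam)).map
      fun x => max 0 (x.1.1 + x.1.2 - x.2)

section

variable {lam : ℝ} {ν : Measure ℝ}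

lemma isProbabilityMeasure_lindleyLaw (hlam : 0 < lam) [IsProbabilityMeasure ν] (n : ℕ) :
    IsProbabilityMeasure (lindleyLaw lam ν n) := by
  have := isProbabilityMeasure_expMeasure hlam
  induction n with
  | zero => exact Measure.dirac.isProbabilityMeasure
  | succ n ih => exact Measure.isProbabilityMeasure_map (by fun_prop)

lemma lintegral_lindleyLaw_succ (hlam : 0 < lam) [IsProbabilityMeasure ν] (n : ℕ)
    {g : ℝ → ℝ≥0∞} (hg : Measurable g) :
    ∫⁻ x, g x ∂(lindleyLaw lam ν (n + 1))
      = ∫⁻ w, ∫⁻ b, ∫⁻ a, g (max 0 (w + b - a)) ∂(expMeasure lam) ∂ν ∂(lindleyLaw lam ν n) := by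
  have := isProbabilityMeasure_expMeasure hlam
  have := isProbabilityMeasure_lindleyLaw hlam (ν := ν) n
  have hm : Measurable fun x : (ℝ × ℝ) × ℝ => g (max 0 (x.1.1 + x.1.2 - x.2)) :=
    hg.comp (by fun_prop)
  rw [lindleyLaw, lintegral_map hg (by fun_prop), lintegral_prod _ hm.aemeasurable,
    lintegral_prod _ hm.lintegral_prod_right'.aemeasurable]

lemma ae_nonneg_lindleyLaw (n : ℕ) : ∀ᵐ w ∂(lindleyLaw lam ν n), 0 ≤ w := by
  cases n with
  | zero => exact (ae_dirac_iff measurableSet_Ici).mpr le_rfl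
  | succ n =>
    rw [lindleyLaw]
    exact (ae_map_iff (by fun_prop) measurableSet_Ici).mpr (ae_of_all _ fun x => le_max_left _ _)

lemma lintegral_max_pow (k : ℕ) (u : ℝ) :
    ∫⁻ a, ENNReal.ofReal (max 0 (u - a)) ^ (k + 1) ∂(expMeasure lam)
      = overshoot lam (k + 1) u := by
  refine lintegral_congr fun a => ?_
  split_ifs with h
  · rw [max_eq_right (by linarith), ENNReal.ofReal_pow (by linarith)]
  · rw [max_eq_left (by linarith), ENNReal.ofReal_zero, zero_pow (by omega)]

/-- `overshoot_succ_add` is averaged over `r = w + b`. Exponents start at `k + 1 ≥ 1`, since only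
for positive exponents does the moment of `max 0 (r - A)` ignore the event `A ≥ r` and agree with
`overshoot`. -/
lemma powMoment_lindleyLaw_succ (hlam : 0 < lam) [IsProbabilityMeasure ν]
    (hν : ∀ᵐ b ∂ν, 0 ≤ b) (k n : ℕ) :
    powMoment (lindleyLaw lam ν (n + 1)) (k + 2)
        + ENNReal.ofReal ((k + 2) / lam) * powMoment (lindleyLaw lam ν (n + 1)) (k + 1)
      = ∫⁻ w, ∫⁻ b, (ENNReal.ofReal w + ENNReal.ofReal b) ^ (k + 2) ∂ν ∂(lindleyLaw lam ν n) := by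
  have hm : ∀ j, Measurable fun w => ∫⁻ b, overshoot lam j (w + b) ∂ν := fun j =>
    Measurable.lintegral_prod_right' (f := fun p : ℝ × ℝ => overshoot lam j (p.1 + p.2))
      ((measurable_overshoot hlam j).comp (by fun_prop))
  have hm' : ∀ j (w : ℝ), Measurable fun b => overshoot lam j (w + b) := fun j w =>
    (measurable_overshoot hlam j).comp (measurable_const_add w)
  have e : ∀ j, powMoment (lindleyLaw lam ν (n + 1)) (j + 1)
      = ∫⁻ w, ∫⁻ b, overshoot lam (j + 1) (w + b) ∂ν ∂(lindleyLaw lam ν n) := by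
    intro j
    rw [powMoment, lintegral_lindleyLaw_succ hlam n (by fun_prop)]
    simp only [lintegral_max_pow]
  rw [e, e, ← lintegral_const_mul _ (hm _),
    ← lintegral_add_left (hm _)]
  refine lintegral_congr_ae ?_
  filter_upwards [ae_nonneg_lindleyLaw n] with w hw
  rw [← lintegral_const_mul _ (hm' _ _), ← lintegral_add_left (hm' _ _)]
  refine lintegral_congr_ae ?_
  filter_upwards [hν] with b hb
  have := overshoot_succ_add hlam (k + 1) (add_nonneg hw hb)
  rw [← ENNReal.ofReal_add hw hb, ← ENNReal.ofReal_pow (by positivity), ← this]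
  push_cast
  ring_nf

lemma powMoment_lindleyLaw_two (hlam : 0 < lam) [IsProbabilityMeasure ν]
    (hν : ∀ᵐ b ∂ν, 0 ≤ b) (n : ℕ) :
    powMoment (lindleyLaw lam ν (n + 1)) 2
        + ENNReal.ofReal (2 / lam) * powMoment (lindleyLaw lam ν (n + 1)) 1
      = powMoment (lindleyLaw lam ν n) 2
        + 2 * powMoment ν 1 * powMoment (lindleyLaw lam ν n) 1 + powMoment ν 2 := by
  have := isProbabilityMeasure_lindleyLaw hlam (ν := ν) n
  have h := powMoment_lindleyLaw_succ hlam hν 0 n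
  simp only [Nat.cast_zero, zero_add] at h
  rw [h]
  have e : ∀ w, ∫⁻ b, (ENNReal.ofReal w + ENNReal.ofReal b) ^ 2 ∂ν
      = ENNReal.ofReal w ^ 2 + 2 * powMoment ν 1 * ENNReal.ofReal w ^ 1 + powMoment ν 2 := by
    intro w
    have : ∀ b, (ENNReal.ofReal w + ENNReal.ofReal b) ^ 2 = ENNReal.ofReal w ^ 2
        + 2 * ENNReal.ofReal w * ENNReal.ofReal b ^ 1 + ENNReal.ofReal b ^ 2 := fun b => by ring
    simp only [this]
    rw [lintegral_add_left (by fun_prop), lintegral_add_left (by fun_prop),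
      lintegral_const_mul _ (by fun_prop), lintegral_const, measure_univ, powMoment, powMoment]
    ring
  simp only [e]
  rw [lintegral_add_left (by fun_prop), lintegral_add_left (by fun_prop),
    lintegral_const_mul _ (by fun_prop), lintegral_const, measure_univ, mul_one]
  rfl

lemma powMoment_lindleyLaw_three (hlam : 0 < lam) [IsProbabilityMeasure ν]
    (hν : ∀ᵐ b ∂ν, 0 ≤ b) (n : ℕ) :
    powMoment (lindleyLaw lam ν (n + 1)) 3
        + ENNReal.ofReal (3 / lam) * powMoment (lindleyLaw lam ν (n + 1)) 2
      = powMoment (lindleyLaw lam ν n) 3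
        + 3 * powMoment ν 1 * powMoment (lindleyLaw lam ν n) 2
        + 3 * powMoment ν 2 * powMoment (lindleyLaw lam ν n) 1 + powMoment ν 3 := by
  have := isProbabilityMeasure_lindleyLaw hlam (ν := ν) n
  have h := powMoment_lindleyLaw_succ hlam hν 1 n
  norm_num at h
  rw [h]
  have e : ∀ w, ∫⁻ b, (ENNReal.ofReal w + ENNReal.ofReal b) ^ 3 ∂ν
      = ENNReal.ofReal w ^ 3 + 3 * powMoment ν 1 * ENNReal.ofReal w ^ 2
        + 3 * powMoment ν 2 * ENNReal.ofReal w ^ 1 + powMoment ν 3 := by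
    intro w
    have : ∀ b, (ENNReal.ofReal w + ENNReal.ofReal b) ^ 3 = ENNReal.ofReal w ^ 3
        + 3 * ENNReal.ofReal w ^ 2 * ENNReal.ofReal b ^ 1
        + 3 * ENNReal.ofReal w * ENNReal.ofReal b ^ 2 + ENNReal.ofReal b ^ 3 := fun b => by ring
    simp only [this]
    rw [lintegral_add_left (by fun_prop), lintegral_add_left (by fun_prop),
      lintegral_add_left (by fun_prop), lintegral_const_mul _ (by fun_prop),
      lintegral_const_mul _ (by fun_prop), lintegral_const, measure_univ, powMoment, powMoment,
      powMoment]
    ring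
  simp only [e]
  rw [lintegral_add_left (by fun_prop), lintegral_add_left (by fun_prop),
    lintegral_add_left (by fun_prop), lintegral_const_mul _ (by fun_prop),
    lintegral_const_mul _ (by fun_prop), lintegral_const, measure_univ, mul_one]
  rfl

/-- The start `0` is the least state and the recursion is monotone in `w`, so the order between
terms `0` and `1` propagates. All monotone `g` are treated at once because the induction hypothesis
is applied to the average of `g` over one step. -/
lemma lintegral_mono_lindleyLaw_succ (hlam : 0 < lam) [IsProbabilityMeasure ν] (n : ℕ) :
    ∀ {g : ℝ → ℝ≥0∞}, Monotone g →
      ∫⁻ x, g x ∂(lindleyLaw lam ν n) ≤ ∫⁻ x, g x ∂(lindleyLaw lam ν (n + 1)) := by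
  have := isProbabilityMeasure_expMeasure hlam
  induction n with
  | zero =>
    intro g hg
    rw [lintegral_lindleyLaw_succ hlam 0 hg.measurable, lindleyLaw,
      lintegral_dirac' _ hg.measurable]
    have hmono : ∀ w b a : ℝ, g 0 ≤ g (max 0 (w + b - a)) := fun w b a => hg (le_max_left _ _)
    calc g 0 = ∫⁻ _, ∫⁻ _, ∫⁻ _, g 0 ∂(expMeasure lam) ∂ν ∂(Measure.dirac (0 : ℝ)) := by simp
      _ ≤ _ := lintegral_mono fun w => lintegral_mono fun b => lintegral_mono fun a => hmono w b a
  | succ n ih =>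
    intro g hg
    rw [lintegral_lindleyLaw_succ hlam n hg.measurable,
      lintegral_lindleyLaw_succ hlam (n + 1) hg.measurable]
    exact ih fun w w' h => lintegral_mono fun b => lintegral_mono fun a =>
      hg (max_le_max_left _ (by linarith))

/-- Smaller inputs give a stochastically smaller recursion; this serves for truncated service times.
-/
lemma lintegral_lindleyLaw_map_le (hlam : 0 < lam) [IsProbabilityMeasure ν] {τ : ℝ → ℝ}
    (hτm : Measurable τ) (hτ : ∀ x, τ x ≤ x) (n : ℕ) :
    ∀ {g : ℝ → ℝ≥0∞}, Monotone g →
      ∫⁻ x, g x ∂(lindleyLaw lam (ν.map τ) n) ≤ ∫⁻ x, g x ∂(lindleyLaw lam ν n) := by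
  have := isProbabilityMeasure_expMeasure hlam
  have := Measure.isProbabilityMeasure_map (μ := ν) hτm.aemeasurable
  induction n with
  | zero => exact fun _ => le_rfl
  | succ n ih =>
    intro g hg
    rw [lintegral_lindleyLaw_succ hlam n hg.measurable,
      lintegral_lindleyLaw_succ hlam n hg.measurable]
    have hmono : Monotone fun w => ∫⁻ b, ∫⁻ a, g (max 0 (w + b - a)) ∂(expMeasure lam) ∂ν :=
      fun w w' h => lintegral_mono fun b => lintegral_mono fun a =>
        hg (max_le_max_left _ (by linarith))
    refine le_trans (lintegral_mono fun w => ?_) (ih hmono)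
    have hm : Monotone fun b => ∫⁻ a, g (max 0 (w + b - a)) ∂(expMeasure lam) :=
      fun b b' h => lintegral_mono fun a => hg (max_le_max_left _ (by linarith))
    rw [lintegral_map hm.measurable hτm]
    exact lintegral_mono fun b => hm (hτ b)

lemma monotone_ofReal_pow (k : ℕ) : Monotone fun x : ℝ => ENNReal.ofReal x ^ k :=
  fun _ _ h => pow_le_pow_left' (ENNReal.ofReal_le_ofReal h) k

lemma powMoment_one_le [IsProbabilityMeasure ν] : powMoment ν 1 ≤ powMoment ν 2 + 1 := by
  calc powMoment ν 1 ≤ ∫⁻ x, (ENNReal.ofReal x ^ 2 + 1) ∂ν := by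
        refine lintegral_mono fun x => ?_
        rcases le_total (ENNReal.ofReal x) 1 with h | h
        · simpa using h.trans le_add_self
        · exact (pow_le_pow_right₀ h (by norm_num)).trans le_self_add
    _ = powMoment ν 2 + 1 := by
        rw [lintegral_add_left (by fun_prop), lintegral_const, measure_univ, mul_one]; rfl

lemma powMoment_lindleyLaw_two_ne_top (hlam : 0 < lam) [IsProbabilityMeasure ν]
    (hν : ∀ᵐ b ∂ν, 0 ≤ b) (h2 : powMoment ν 2 ≠ ∞) (n : ℕ) :
    powMoment (lindleyLaw lam ν n) 2 ≠ ∞ := by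
  induction n with
  | zero => simp [powMoment, lindleyLaw]
  | succ n ih =>
    have := isProbabilityMeasure_lindleyLaw hlam (ν := ν) n
    have h1 : powMoment ν 1 ≠ ∞ :=
      ne_top_of_le_ne_top (ENNReal.add_ne_top.mpr ⟨h2, ENNReal.one_ne_top⟩) powMoment_one_le
    have h1' : powMoment (lindleyLaw lam ν n) 1 ≠ ∞ :=
      ne_top_of_le_ne_top (ENNReal.add_ne_top.mpr ⟨ih, ENNReal.one_ne_top⟩) powMoment_one_le
    refine ne_top_of_le_ne_top ?_ (le_self_add.trans (powMoment_lindleyLaw_two hlam hν n).le)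
    finiteness

lemma powMoment_lindleyLaw_one_ne_top (hlam : 0 < lam) [IsProbabilityMeasure ν]
    (hν : ∀ᵐ b ∂ν, 0 ≤ b) (h2 : powMoment ν 2 ≠ ∞) (n : ℕ) :
    powMoment (lindleyLaw lam ν n) 1 ≠ ∞ := by
  have := isProbabilityMeasure_lindleyLaw hlam (ν := ν) n
  exact ne_top_of_le_ne_top (ENNReal.add_ne_top.mpr
    ⟨powMoment_lindleyLaw_two_ne_top hlam hν h2 n, ENNReal.one_ne_top⟩) powMoment_one_le

lemma powMoment_lindleyLaw_three_ne_top (hlam : 0 < lam) [IsProbabilityMeasure ν]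
    (hν : ∀ᵐ b ∂ν, 0 ≤ b) (h2 : powMoment ν 2 ≠ ∞) (h3 : powMoment ν 3 ≠ ∞) (n : ℕ) :
    powMoment (lindleyLaw lam ν n) 3 ≠ ∞ := by
  induction n with
  | zero => simp [powMoment, lindleyLaw]
  | succ n ih =>
    have h1 : powMoment ν 1 ≠ ∞ :=
      ne_top_of_le_ne_top (ENNReal.add_ne_top.mpr ⟨h2, ENNReal.one_ne_top⟩) powMoment_one_le
    have h1' := powMoment_lindleyLaw_one_ne_top hlam hν h2 n
    have h2' := powMoment_lindleyLaw_two_ne_top hlam hν h2 n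
    refine ne_top_of_le_ne_top ?_ (le_self_add.trans (powMoment_lindleyLaw_three hlam hν n).le)
    finiteness

lemma powMoment_lindleyLaw_mono (hlam : 0 < lam) [IsProbabilityMeasure ν] (k : ℕ) :
    Monotone fun n => powMoment (lindleyLaw lam ν n) k :=
  monotone_nat_of_le_succ fun n => lintegral_mono_lindleyLaw_succ hlam n (monotone_ofReal_pow k)

end

/-! ### The Pollaczek–Khinchine limit -/

/-- The second-moment balance of Lindley's recursion bounds the first moments. -/
lemma balance_le {lam b₁ b₂ : ℝ} (hlam : 0 < lam) (hst : lam * b₁ < 1) (hb₁ : 0 ≤ b₁)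
    {m q : ℕ → ℝ} (hm : Monotone m) (hq : Monotone q)
    (h2 : ∀ n, q (n + 1) + 2 / lam * m (n + 1) = q n + 2 * b₁ * m n + b₂) (n : ℕ) :
    m n ≤ lam * b₂ / (2 * (1 - lam * b₁)) := by
  have e := h2 n
  have h1 := hm (Nat.le_succ n)
  have h3 := hq (Nat.le_succ n)
  simp only [Nat.succ_eq_add_one] at h1 h3
  have h4 : b₁ * m n ≤ b₁ * m (n + 1) := mul_le_mul_of_nonneg_left h1 hb₁
  -- The increment of `q` is nonnegative and is dropped from the balance.
  have h5 : 2 / lam * m (n + 1) ≤ 2 * (b₁ * m (n + 1)) + b₂ := by linarith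
  rw [le_div_iff₀ (by linarith)]
  have h6 := mul_le_mul_of_nonneg_left h5 hlam.le
  have h7 : lam * (2 / lam * m (n + 1)) = 2 * m (n + 1) := by field_simp
  have h8 : m n * (2 * (1 - lam * b₁)) ≤ m (n + 1) * (2 * (1 - lam * b₁)) :=
    mul_le_mul_of_nonneg_right h1 (by linarith)
  linarith

/-- The bound of `balance_le` is attained in the limit as soon as the increments of `q` tend to
zero. The third-moment balance is there only to bound the monotone sequence `q`. -/
lemma balance_tendsto {lam b₁ b₂ b₃ : ℝ} (hlam : 0 < lam) (hst : lam * b₁ < 1) (hb₁ : 0 ≤ b₁)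
    (hb₂ : 0 ≤ b₂) {m q t : ℕ → ℝ} (hm : Monotone m) (hq : Monotone q) (ht : Monotone t)
    (h2 : ∀ n, q (n + 1) + 2 / lam * m (n + 1) = q n + 2 * b₁ * m n + b₂)
    (h3 : ∀ n, t (n + 1) + 3 / lam * q (n + 1)
      = t n + 3 * b₁ * q n + 3 * b₂ * m n + b₃) :
    Tendsto m atTop (𝓝 (lam * b₂ / (2 * (1 - lam * b₁)))) := by
  have hmb := balance_le hlam hst hb₁ hm hq h2
  set w := lam * b₂ / (2 * (1 - lam * b₁)) with hw
  have hqb : ∀ n, q n ≤ lam * (3 * b₂ * w + b₃) / (3 * (1 - lam * b₁)) := by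
    intro n
    have e := h3 n
    have h1 := hq (Nat.le_succ n)
    have h4 := ht (Nat.le_succ n)
    simp only [Nat.succ_eq_add_one] at h1 h4
    have h5 : b₁ * q n ≤ b₁ * q (n + 1) := mul_le_mul_of_nonneg_left h1 hb₁
    have h6 : b₂ * m n ≤ b₂ * w := mul_le_mul_of_nonneg_left (hmb n) hb₂
    have h7 : 3 / lam * q (n + 1) ≤ 3 * (b₁ * q (n + 1)) + 3 * b₂ * w + b₃ := by linarith
    rw [le_div_iff₀ (by linarith)]
    have h8 := mul_le_mul_of_nonneg_left h7 hlam.le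
    have h9 : lam * (3 / lam * q (n + 1)) = 3 * q (n + 1) := by field_simp
    have h10 : q n * (3 * (1 - lam * b₁)) ≤ q (n + 1) * (3 * (1 - lam * b₁)) :=
      mul_le_mul_of_nonneg_right h1 (by linarith)
    linarith
  obtain ⟨x, hx⟩ : ∃ x, Tendsto m atTop (𝓝 x) :=
    ⟨_, tendsto_atTop_ciSup hm ⟨w, by rintro _ ⟨n, rfl⟩; exact hmb n⟩⟩
  obtain ⟨y, hy⟩ : ∃ y, Tendsto q atTop (𝓝 y) :=
    ⟨_, tendsto_atTop_ciSup hq ⟨_, by rintro _ ⟨n, rfl⟩; exact hqb n⟩⟩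
  have hx' := (tendsto_add_atTop_iff_nat 1).mpr hx
  have hy' := (tendsto_add_atTop_iff_nat 1).mpr hy
  have lim1 := hy'.add (hx'.const_mul (2 / lam))
  have lim2 := (hy.add (hx.const_mul (2 * b₁))).add_const b₂
  -- The limit `y` of `q` occurs on both sides and cancels, leaving a linear equation for `x`.
  have e := tendsto_nhds_unique (lim1.congr h2) lim2
  have : x = w := by
    rw [hw, eq_div_iff (by linarith)]
    have e2 : 2 / lam * x = 2 * b₁ * x + b₂ := by linarith
    field_simp at e2
    linarith
  rwa [this] at hx

section

variable {lam : ℝ} {ν : Measure ℝ}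

lemma toReal_powMoment_two_balance (hlam : 0 < lam) [IsProbabilityMeasure ν]
    (hν : ∀ᵐ b ∂ν, 0 ≤ b) (h2 : powMoment ν 2 ≠ ∞) (n : ℕ) :
    (powMoment (lindleyLaw lam ν (n + 1)) 2).toReal
        + 2 / lam * (powMoment (lindleyLaw lam ν (n + 1)) 1).toReal
      = (powMoment (lindleyLaw lam ν n) 2).toReal
        + 2 * (powMoment ν 1).toReal * (powMoment (lindleyLaw lam ν n) 1).toReal
        + (powMoment ν 2).toReal := by
  have h1 : powMoment ν 1 ≠ ∞ :=
    ne_top_of_le_ne_top (ENNReal.add_ne_top.mpr ⟨h2, ENNReal.one_ne_top⟩) powMoment_one_le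
  have f1 := powMoment_lindleyLaw_one_ne_top hlam hν h2
  have f2 := powMoment_lindleyLaw_two_ne_top hlam hν h2
  have := congrArg ENNReal.toReal (powMoment_lindleyLaw_two hlam hν n)
  rw [ENNReal.toReal_add (f2 _) (by finiteness [f1 (n + 1)]), ENNReal.toReal_add
    (by finiteness [f2 n, f1 n]) h2, ENNReal.toReal_add (f2 _) (by finiteness [f1 n])] at this
  simpa [ENNReal.toReal_mul, ENNReal.toReal_ofReal (show 0 ≤ 2 / lam by positivity)] using this

lemma toReal_powMoment_three_balance (hlam : 0 < lam) [IsProbabilityMeasure ν]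
    (hν : ∀ᵐ b ∂ν, 0 ≤ b) (h2 : powMoment ν 2 ≠ ∞) (h3 : powMoment ν 3 ≠ ∞) (n : ℕ) :
    (powMoment (lindleyLaw lam ν (n + 1)) 3).toReal
        + 3 / lam * (powMoment (lindleyLaw lam ν (n + 1)) 2).toReal
      = (powMoment (lindleyLaw lam ν n) 3).toReal
        + 3 * (powMoment ν 1).toReal * (powMoment (lindleyLaw lam ν n) 2).toReal
        + 3 * (powMoment ν 2).toReal * (powMoment (lindleyLaw lam ν n) 1).toReal
        + (powMoment ν 3).toReal := by
  have h1 : powMoment ν 1 ≠ ∞ :=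
    ne_top_of_le_ne_top (ENNReal.add_ne_top.mpr ⟨h2, ENNReal.one_ne_top⟩) powMoment_one_le
  have f1 := powMoment_lindleyLaw_one_ne_top hlam hν h2
  have f2 := powMoment_lindleyLaw_two_ne_top hlam hν h2
  have f3 := powMoment_lindleyLaw_three_ne_top hlam hν h2 h3
  have := congrArg ENNReal.toReal (powMoment_lindleyLaw_three hlam hν n)
  rw [ENNReal.toReal_add (f3 _) (by finiteness [f2 (n + 1)]), ENNReal.toReal_add
    (by finiteness [f3 n, f2 n, f1 n]) h3, ENNReal.toReal_add (by finiteness [f3 n, f2 n])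
    (by finiteness [f1 n]), ENNReal.toReal_add (f3 _) (by finiteness [f2 n])] at this
  simpa [ENNReal.toReal_mul, ENNReal.toReal_ofReal (show 0 ≤ 3 / lam by positivity)] using this

lemma toReal_powMoment_mono (hlam : 0 < lam) [IsProbabilityMeasure ν] {k : ℕ}
    (h : ∀ n, powMoment (lindleyLaw lam ν n) k ≠ ∞) :
    Monotone fun n => (powMoment (lindleyLaw lam ν n) k).toReal :=
  fun _ j hij => ENNReal.toReal_mono (h j) (powMoment_lindleyLaw_mono hlam k hij)

lemma tendsto_powMoment_lindleyLaw_of_three (hlam : 0 < lam) [IsProbabilityMeasure ν]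
    (hν : ∀ᵐ b ∂ν, 0 ≤ b) (h2 : powMoment ν 2 ≠ ∞) (h3 : powMoment ν 3 ≠ ∞)
    (hst : lam * (powMoment ν 1).toReal < 1) :
    Tendsto (fun n => (powMoment (lindleyLaw lam ν n) 1).toReal) atTop
      (𝓝 (lam * (powMoment ν 2).toReal / (2 * (1 - lam * (powMoment ν 1).toReal)))) :=
  balance_tendsto hlam hst ENNReal.toReal_nonneg ENNReal.toReal_nonneg
    (toReal_powMoment_mono hlam (powMoment_lindleyLaw_one_ne_top hlam hν h2))
    (toReal_powMoment_mono hlam (powMoment_lindleyLaw_two_ne_top hlam hν h2))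
    (toReal_powMoment_mono hlam (powMoment_lindleyLaw_three_ne_top hlam hν h2 h3))
    (toReal_powMoment_two_balance hlam hν h2)
    (toReal_powMoment_three_balance hlam hν h2 h3)

lemma powMoment_truncate_tendsto (k : ℕ) (hk : powMoment ν k ≠ ∞) :
    Tendsto (fun c : ℕ => (powMoment (ν.map fun x => min x c) k).toReal) atTop
      (𝓝 (powMoment ν k).toReal) := by
  refine (ENNReal.tendsto_toReal hk).comp ?_
  have e : ∀ c : ℕ, powMoment (ν.map fun x => min x c) k
      = ∫⁻ x, ENNReal.ofReal (min x c) ^ k ∂ν := fun c =>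
    lintegral_map (by fun_prop) (by fun_prop)
  simp only [e]
  refine lintegral_tendsto_of_tendsto_of_monotone (fun c => by fun_prop)
    (ae_of_all _ fun x c c' h => ?_) (ae_of_all _ fun x => ?_)
  · exact monotone_ofReal_pow k (min_le_min_left x (by exact_mod_cast h))
  · obtain ⟨c, hc⟩ := exists_nat_ge x
    refine tendsto_const_nhds.congr' ?_
    filter_upwards [eventually_ge_atTop c] with c' hc'
    rw [min_eq_left (hc.trans (by exact_mod_cast hc'))]

/-- The Pollaczek–Khinchine mean-value formula: the mean workload found by the `n`-th arrival
converges to its stationary value. -/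
theorem tendsto_powMoment_lindleyLaw (hlam : 0 < lam) [IsProbabilityMeasure ν]
    (hν : ∀ᵐ b ∂ν, 0 ≤ b) (h2 : powMoment ν 2 ≠ ∞) (hst : lam * (powMoment ν 1).toReal < 1) :
    Tendsto (fun n => (powMoment (lindleyLaw lam ν n) 1).toReal) atTop
      (𝓝 (lam * (powMoment ν 2).toReal / (2 * (1 - lam * (powMoment ν 1).toReal)))) := by
  have h1 : powMoment ν 1 ≠ ∞ :=
    ne_top_of_le_ne_top (ENNReal.add_ne_top.mpr ⟨h2, ENNReal.one_ne_top⟩) powMoment_one_le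
  have hmono := toReal_powMoment_mono hlam (powMoment_lindleyLaw_one_ne_top hlam hν h2)
  have hub := balance_le hlam hst ENNReal.toReal_nonneg hmono
    (toReal_powMoment_mono hlam (powMoment_lindleyLaw_two_ne_top hlam hν h2))
    (toReal_powMoment_two_balance hlam hν h2)
  obtain ⟨x, hx⟩ : ∃ x, Tendsto (fun n => (powMoment (lindleyLaw lam ν n) 1).toReal) atTop (𝓝 x) :=
    ⟨_, tendsto_atTop_ciSup hmono ⟨_, by rintro _ ⟨n, rfl⟩; exact hub n⟩⟩
  -- The upper bound needs no third moment; the lower bound comes from service truncated at `c`,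
  -- which has all moments, as `c → ∞`.
  have hxle := le_of_tendsto' hx hub
  have hlim : Tendsto (fun c : ℕ => lam * (powMoment (ν.map fun x => min x c) 2).toReal
      / (2 * (1 - lam * (powMoment (ν.map fun x => min x c) 1).toReal))) atTop
      (𝓝 (lam * (powMoment ν 2).toReal / (2 * (1 - lam * (powMoment ν 1).toReal)))) :=
    ((powMoment_truncate_tendsto 2 h2).const_mul lam).div
      ((((powMoment_truncate_tendsto 1 h1).const_mul lam).const_sub 1).const_mul 2)
      (by linarith)
  have hge : ∀ c : ℕ, lam * (powMoment (ν.map fun x => min x c) 2).toReal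
      / (2 * (1 - lam * (powMoment (ν.map fun x => min x c) 1).toReal)) ≤ x := by
    intro c
    have hτ : Measurable fun x : ℝ => min x (c : ℝ) := by fun_prop
    have := Measure.isProbabilityMeasure_map (μ := ν) hτ.aemeasurable
    have hfin : ∀ k, powMoment (ν.map fun x => min x (c : ℝ)) k ≠ ∞ := by
      intro k
      rw [powMoment, lintegral_map (by fun_prop) hτ]
      refine ne_top_of_le_ne_top (b := ENNReal.ofReal c ^ k) (by finiteness) ?_
      calc _ ≤ ∫⁻ _, ENNReal.ofReal c ^ k ∂ν :=
            lintegral_mono fun x => monotone_ofReal_pow k (min_le_right _ _)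
        _ = _ := by simp
    have hle1 : powMoment (ν.map fun x => min x (c : ℝ)) 1 ≤ powMoment ν 1 := by
      rw [powMoment, lintegral_map (by fun_prop) hτ]
      exact lintegral_mono fun x => monotone_ofReal_pow 1 (min_le_left _ _)
    have hnn : ∀ᵐ b ∂(ν.map fun x => min x (c : ℝ)), 0 ≤ b := by
      refine (ae_map_iff hτ.aemeasurable measurableSet_Ici).mpr ?_
      filter_upwards [hν] with b hb
      exact le_min hb (Nat.cast_nonneg c)
    have hst' : lam * (powMoment (ν.map fun x => min x (c : ℝ)) 1).toReal < 1 :=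
      (mul_le_mul_of_nonneg_left (ENNReal.toReal_mono h1 hle1) hlam.le).trans_lt hst
    refine le_of_tendsto_of_tendsto'
      (tendsto_powMoment_lindleyLaw_of_three hlam hnn (hfin 2) (hfin 3) hst') hx fun n => ?_
    exact ENNReal.toReal_mono (powMoment_lindleyLaw_one_ne_top hlam hν h2 n)
      (lintegral_lindleyLaw_map_le hlam hτ (fun x => min_le_left _ _) n (monotone_ofReal_pow 1))
  rwa [le_antisymm hxle (le_of_tendsto' hlim hge)] at hx

end

/-! ### Independence of the input, expressed by resampling -/

/-- Resampling one coordinate of an i.i.d. sequence does not change its law. -/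
lemma map_update_infinitePi {X : Type*} [MeasurableSpace X] (μ : Measure X)
    [IsProbabilityMeasure μ] (n : ℕ) :
    ((Measure.infinitePi fun _ : ℕ => μ).prod μ).map (fun p => Function.update p.1 n p.2)
      = Measure.infinitePi fun _ : ℕ => μ := by
  refine Measure.eq_infinitePi _ fun s t ht => ?_
  have hpre : (fun p : (ℕ → X) × X => Function.update p.1 n p.2) ⁻¹' (Set.pi s t)
      = (Set.pi (s.erase n : Finset ℕ) t) ×ˢ (if n ∈ s then t n else Set.univ) := by
    ext ⟨ω, x⟩
    simp only [Set.mem_preimage, Set.mem_pi, Finset.mem_coe, Set.mem_prod, Finset.mem_erase]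
    constructor
    · intro h
      refine ⟨fun i hi => ?_, ?_⟩
      · simpa [Function.update_of_ne hi.1] using h i hi.2
      · split_ifs with hn
        · simpa using h n hn
        · trivial
    · rintro ⟨h, h'⟩ i hi
      by_cases hin : i = n
      · subst hin
        simpa [hi] using h'
      · simpa [Function.update_of_ne hin] using h i ⟨hin, hi⟩
  rw [Measure.map_apply measurable_update' (MeasurableSet.pi s.countable_toSet fun i _ => ht i),
    hpre, Measure.prod_prod, Measure.infinitePi_pi _ fun i _ => ht i]
  split_ifs with hn
  · rw [mul_comm, Finset.mul_prod_erase s (fun i => μ (t i)) hn]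
  · rw [measure_univ, mul_one, Finset.erase_eq_of_notMem hn]

lemma lintegral_update_infinitePi {X : Type*} [MeasurableSpace X] (μ : Measure X)
    [IsProbabilityMeasure μ] (n : ℕ) {F : (ℕ → X) → ℝ≥0∞} (hF : Measurable F) :
    ∫⁻ ω, F ω ∂(Measure.infinitePi fun _ : ℕ => μ)
      = ∫⁻ ω, ∫⁻ x, F (Function.update ω n x) ∂μ ∂(Measure.infinitePi fun _ : ℕ => μ) := by
  conv_lhs => rw [← map_update_infinitePi μ n]
  rw [lintegral_map hF measurable_update', lintegral_prod]
  exact (hF.comp measurable_update').aemeasurable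

/-- Joint law of the service requirement and the class of a customer. -/
noncomputable abbrev markLaw (G : Measure ℝ) (φ : I) : Measure (ℝ × Bool) :=
  G.prod (bernoulliMeasure true false φ)

section

variable {lam : ℝ} {G : Measure ℝ} {φ : I}

lemma isProbabilityMeasure_inputLaw (hlam : 0 < lam) [IsProbabilityMeasure G] :
    IsProbabilityMeasure (inputLaw lam G φ) := by
  have := isProbabilityMeasure_expMeasure hlam
  rw [inputLaw]
  infer_instance

lemma lintegral_resample (hlam : 0 < lam) [IsProbabilityMeasure G] (n : ℕ)
    {F : Input → ℝ≥0∞} (hF : Measurable F) :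
    ∫⁻ ω, F ω ∂(inputLaw lam G φ)
      = ∫⁻ ω, ∫⁻ y, ∫⁻ a, F (Function.update ω n (a, y)) ∂(expMeasure lam) ∂(markLaw G φ)
          ∂(inputLaw lam G φ) := by
  have := isProbabilityMeasure_expMeasure hlam
  rw [inputLaw, lintegral_update_infinitePi _ n hF]
  refine lintegral_congr fun ω => ?_
  rw [lintegral_prod_symm]
  exact (hF.comp (measurable_update ω)).aemeasurable

/-- Both sides are resampled in the whole coordinate `n`: on the right the inner gap overwrites the
resampled one, so only the fresh mark survives. -/
lemma lintegral_resample_gap (hlam : 0 < lam) [IsProbabilityMeasure G] (n : ℕ)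
    {F : Input → ℝ≥0∞} (hF : Measurable F) :
    ∫⁻ ω, F ω ∂(inputLaw lam G φ)
      = ∫⁻ ω, ∫⁻ a, F (Function.update ω n (a, (ω n).2)) ∂(expMeasure lam)
          ∂(inputLaw lam G φ) := by
  have := isProbabilityMeasure_expMeasure hlam
  have hm : Measurable fun p : Input × ℝ => Function.update p.1 n (p.2, (p.1 n).2) :=
    measurable_update'.comp (f := fun p : Input × ℝ => (p.1, (p.2, (p.1 n).2))) (by fun_prop)
  have hg : Measurable fun ω : Input =>
      ∫⁻ a, F (Function.update ω n (a, (ω n).2)) ∂(expMeasure lam) :=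
    (hF.comp hm).lintegral_prod_right'
  rw [lintegral_resample hlam n hF, lintegral_resample hlam n hg]
  refine lintegral_congr fun ω => lintegral_congr fun y => ?_
  simp [Function.update_idem]

lemma lintegral_resample_mark (hlam : 0 < lam) [IsProbabilityMeasure G] (n : ℕ)
    {F : Input → ℝ≥0∞} (hF : Measurable F) :
    ∫⁻ ω, F ω ∂(inputLaw lam G φ)
      = ∫⁻ ω, ∫⁻ y, F (Function.update ω n ((ω n).1, y)) ∂(markLaw G φ)
          ∂(inputLaw lam G φ) := by
  have := isProbabilityMeasure_expMeasure hlam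
  have hm : Measurable fun p : Input × (ℝ × Bool) => Function.update p.1 n ((p.1 n).1, p.2) :=
    measurable_update'.comp (f := fun p : Input × (ℝ × Bool) => (p.1, ((p.1 n).1, p.2)))
      (by fun_prop)
  have hg : Measurable fun ω : Input =>
      ∫⁻ y, F (Function.update ω n ((ω n).1, y)) ∂(markLaw G φ) :=
    (hF.comp hm).lintegral_prod_right'
  rw [lintegral_resample hlam n hF, lintegral_resample hlam n hg]
  refine lintegral_congr fun ω => ?_
  have hm2 : Measurable fun p : (ℝ × Bool) × ℝ => F (Function.update ω n (p.2, p.1)) :=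
    hF.comp ((measurable_update ω).comp measurable_swap)
  rw [lintegral_lintegral_swap hm2.aemeasurable]
  simp [Function.update_idem]

lemma ae_inputLaw (hlam : 0 < lam) [IsProbabilityMeasure G] (hG : ∀ᵐ s ∂G, 0 ≤ s) :
    ∀ᵐ ω ∂(inputLaw lam G φ), ∀ n, 0 ≤ gap ω n ∧ 0 ≤ service ω n := by
  have := isProbabilityMeasure_expMeasure hlam
  refine ae_all_iff.mpr fun n => ?_
  have h1 : ∀ᵐ x ∂((expMeasure lam).prod (markLaw G φ)), 0 ≤ x.1 :=
    Measure.quasiMeasurePreserving_fst.ae (ae_nonneg_expMeasure lam)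
  have h2 : ∀ᵐ x ∂((expMeasure lam).prod (markLaw G φ)), 0 ≤ x.2.1 :=
    Measure.quasiMeasurePreserving_snd.ae (Measure.quasiMeasurePreserving_fst.ae hG)
  exact (measurePreserving_eval_infinitePi
    (fun _ : ℕ => (expMeasure lam).prod (markLaw G φ)) n).quasiMeasurePreserving.ae (h1.and h2)

end

/-! ### Pathwise dynamics under the priority order -/

/-- The position of a customer in the priority order. -/
def priorityKey (ω : Input) (j : ℕ) : Bool ×ₗ ℕ := toLex (!premium ω j, j)

lemma precedes_iff_key {ω : Input} {j i : ℕ} :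
    Precedes ω j i ↔ priorityKey ω j < priorityKey ω i := by
  rw [priorityKey, priorityKey, Prod.Lex.toLex_lt_toLex, Precedes]
  cases premium ω j <;> cases premium ω i <;> simp

lemma Precedes.trans {ω : Input} {k j i : ℕ} (h : Precedes ω k j) (h' : Precedes ω j i) :
    Precedes ω k i :=
  precedes_iff_key.mpr ((precedes_iff_key.mp h).trans (precedes_iff_key.mp h'))

/-- Serving customers in priority order for a time `g` completes `min g` of their total work. -/
lemma sum_served_eq_min {α : Type*} [LinearOrder α] (key : ℕ → α) (hkey : key.Injective)
    {r : ℕ → ℝ} (hr : ∀ j, 0 ≤ r j) {g : ℝ} (hg : 0 ≤ g) (C : Finset ℕ) :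
    ∑ j ∈ C, min (r j) (max 0 (g - ∑ k ∈ C with key k < key j, r k)) = min g (∑ j ∈ C, r j) := by
  -- Customers are added from highest to lowest priority: the new one is last, does not disturb the
  -- others, and gets the time they leave over.
  induction C using Finset.induction_on_max_value key with
  | empty => simp [hg]
  | insert a s ha hmax ih =>
    have hlt : ∀ x ∈ s, key x < key a := fun x hx =>
      lt_of_le_of_ne (hmax x hx) fun h => ha (hkey h ▸ hx)
    rw [Finset.sum_insert ha, Finset.sum_insert ha]
    have e1 : ({k ∈ insert a s | key k < key a}) = s := by
      ext k
      simp only [Finset.mem_filter, Finset.mem_insert]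
      constructor
      · rintro ⟨rfl | hk, h⟩
        · exact absurd h (lt_irrefl _)
        · exact hk
      · exact fun hk => ⟨Or.inr hk, hlt k hk⟩
    have e2 : ∀ j ∈ s, ({k ∈ insert a s | key k < key j}) = {k ∈ s | key k < key j} := by
      intro j hj
      rw [Finset.filter_insert, if_neg (not_lt.mpr (hlt j hj).le)]
    have e3 : ∑ j ∈ s, min (r j) (max 0 (g - ∑ k ∈ insert a s with key k < key j, r k))
        = min g (∑ j ∈ s, r j) := by
      rw [← ih]
      exact Finset.sum_congr rfl fun j hj => by rw [e2 j hj]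
    rw [e1, e3]
    have hs : 0 ≤ ∑ j ∈ s, r j := Finset.sum_nonneg fun j _ => hr j
    have := hr a
    rcases le_total g (∑ j ∈ s, r j) with h | h
    · rw [max_eq_left (by linarith), min_eq_right this, min_eq_left h, min_eq_left (by linarith),
        zero_add]
    · rw [max_eq_right (by linarith), min_eq_right h]
      rcases le_total (r a) (g - ∑ j ∈ s, r j) with h' | h'
      · rw [min_eq_left h', min_eq_right (by linarith)]
      · rw [min_eq_right h', min_eq_left (by linarith)]
        ring

lemma priorityKey_injective (ω : Input) : (priorityKey ω).Injective := fun _ _ h =>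
  congrArg Prod.snd (toLex.injective h)

section

variable {ω : Input}

lemma residual_succ_of_ne {n j : ℕ} (h : j ≠ n + 1) :
    residual ω (n + 1) j
      = residual ω n j - min (residual ω n j) (max 0 (gap ω n - ahead ω n j)) := by
  simp only [residual, if_neg h]
  rfl

lemma residual_self (n : ℕ) : residual ω n n = service ω n := by
  cases n <;> simp [residual]

lemma residual_nonneg (hω : ∀ n, 0 ≤ gap ω n ∧ 0 ≤ service ω n) (n j : ℕ) :
    0 ≤ residual ω n j := by
  cases n with
  | zero =>
    simp only [residual]
    split_ifs
    exacts [(hω 0).2, le_rfl]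
  | succ n =>
    by_cases h : j = n + 1
    · rw [h, residual_self]
      exact (hω _).2
    · rw [residual_succ_of_ne h]
      linarith [min_le_left (residual ω n j) (max 0 (gap ω n - ahead ω n j))]

lemma ahead_nonneg (hω : ∀ n, 0 ≤ gap ω n ∧ 0 ≤ service ω n) (n i : ℕ) : 0 ≤ ahead ω n i := by
  rw [ahead, workAhead]
  exact Finset.sum_nonneg fun j _ => residual_nonneg hω n j

/-- The evolution over one period of the work of a set `p` of customers closed under priority. -/
lemma sum_residual_succ (hω : ∀ n, 0 ≤ gap ω n ∧ 0 ≤ service ω n) {p : ℕ → Prop}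
    [DecidablePred p] (hp : ∀ j i, Precedes ω j i → p i → p j) (n : ℕ) :
    ∑ j ∈ Finset.range (n + 2) with p j, residual ω (n + 1) j
      = max 0 (∑ j ∈ Finset.range (n + 1) with p j, residual ω n j - gap ω n)
        + if p (n + 1) then service ω (n + 1) else 0 := by
  have hsplit : ∑ j ∈ Finset.range (n + 2) with p j, residual ω (n + 1) j
      = ∑ j ∈ Finset.range (n + 1) with p j, residual ω (n + 1) j
        + if p (n + 1) then service ω (n + 1) else 0 := by
    rw [Finset.range_add_one (n := n + 1), Finset.filter_insert]
    split_ifs with h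
    · rw [Finset.sum_insert (by simp), residual_self, add_comm]
    · rw [add_zero]
  rw [hsplit]
  congr 1
  -- Since `p` is closed under priority, all work ahead of a member of `p` already lies in `p`; the
  -- service of `p` is thus governed by `p` alone.
  have hstep : ∀ j ∈ ({j ∈ Finset.range (n + 1) | p j}), residual ω (n + 1) j
      = residual ω n j - min (residual ω n j) (max 0 (gap ω n
          - ∑ k ∈ ({j ∈ Finset.range (n + 1) | p j}) with priorityKey ω k < priorityKey ω j,
            residual ω n k)) := by
    intro j hj
    simp only [Finset.mem_filter, Finset.mem_range] at hj
    rw [residual_succ_of_ne (by omega), ahead, workAhead]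
    congr 5
    ext k
    simp only [Finset.mem_filter, Finset.mem_range, ← precedes_iff_key]
    exact ⟨fun h => ⟨⟨h.1, hp k j h.2 hj.2⟩, h.2⟩, fun h => ⟨h.1.1, h.2⟩⟩
  rw [Finset.sum_congr rfl hstep, Finset.sum_sub_distrib,
    sum_served_eq_min _ (priorityKey_injective ω) (residual_nonneg hω n) (hω n).1]
  rcases le_total (gap ω n) (∑ j ∈ Finset.range (n + 1) with p j, residual ω n j) with h | h
  · rw [min_eq_left h, max_eq_right (by linarith)]
  · rw [min_eq_right h, max_eq_left (by linarith), sub_self]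

/-- Work that a customer of mark `y` brings for the customers of class `c` arriving after him. -/
def load (c : Bool) (y : ℝ × Bool) : ℝ := if c = false ∨ y.2 = true then y.1 else 0

/-- Work that a customer of mark `y` brings for the customers of class `c` arrived before him. -/
def overtake (c : Bool) (y : ℝ × Bool) : ℝ := if y.2 = true ∧ c = false then y.1 else 0

/-- Work that the `n`-th customer would find ahead of him if he were of class `c`. -/
noncomputable def found (ω : Input) (c : Bool) : ℕ → ℝ
  | 0 => 0
  | n + 1 => max 0 (found ω c n + load c (ω n).2 - gap ω n)

/-- All customers, and the premium customers alone, are both closed under priority, so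
`sum_residual_succ` becomes Lindley's recursion. -/
lemma sum_residual_eq_found (hω : ∀ n, 0 ≤ gap ω n ∧ 0 ≤ service ω n) (c : Bool) (n : ℕ) :
    ∑ j ∈ Finset.range (n + 1) with c = false ∨ premium ω j = true, residual ω n j
      = found ω c n + load c (ω n).2 := by
  induction n with
  | zero =>
    simp [residual, found, load, premium, service]
  | succ n ih =>
    have hp : ∀ j i, Precedes ω j i → (c = false ∨ premium ω i = true) →
        (c = false ∨ premium ω j = true) := by
      rintro j i (h | h) (h' | h')
      · exact Or.inl h'
      · exact Or.inr h.1
      · exact Or.inl h'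
      · exact Or.inr (h.1.trans h')
    rw [sum_residual_succ hω hp, ih]
    rfl

/-- At his arrival `i` is last within his class, so the work that counts for his class is the work
ahead of him plus his own service. -/
lemma ahead_self (hω : ∀ n, 0 ≤ gap ω n ∧ 0 ≤ service ω n) (i : ℕ) :
    ahead ω i i = found ω (premium ω i) i := by
  have h := sum_residual_eq_found hω (premium ω i) i
  have hset : ({j ∈ Finset.range (i + 1) | premium ω i = false ∨ premium ω j = true})
      = insert i {j ∈ Finset.range (i + 1) | Precedes ω j i} := by
    ext j
    simp only [Finset.mem_filter, Finset.mem_range, Finset.mem_insert, Precedes]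
    by_cases hji : j = i
    · subst hji
      cases premium ω j <;> simp
    · have : j < i + 1 ↔ j < i := by omega
      cases premium ω i <;> cases premium ω j <;> simp [this, hji]
  rw [hset, Finset.sum_insert (by simp [Precedes]), residual_self] at h
  have hl : load (premium ω i) (ω i).2 = service ω i := by
    rw [load, if_pos]
    · rfl
    · change premium ω i = false ∨ premium ω i = true
      cases premium ω i <;> simp
  rw [hl] at h
  have e : ahead ω i i = ∑ j ∈ Finset.range (i + 1) with Precedes ω j i, residual ω i j := rfl
  linarith

/-- The customers ahead of `i` are closed under priority by transitivity; a later arrival joins them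
only as a premium customer passing an ordinary one. -/
lemma ahead_succ (hω : ∀ n, 0 ≤ gap ω n ∧ 0 ≤ service ω n) {i n : ℕ} (hin : i ≤ n) :
    ahead ω (n + 1) i
      = max 0 (ahead ω n i - gap ω n) + overtake (premium ω i) (ω (n + 1)).2 := by
  have h := sum_residual_succ hω (p := fun j => Precedes ω j i)
    (fun k j hkj hji => hkj.trans hji) n
  have e : Precedes ω (n + 1) i ↔ (ω (n + 1)).2.2 = true ∧ premium ω i = false := by
    have : ¬ n + 1 < i := by omega
    simp only [Precedes, this, and_false, or_false]
    rfl
  simp only [e] at h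
  exact h

/-- Work to be completed before customer `i` can leave, at the start of period `n`. -/
noncomputable def backlog (ω : Input) (n i : ℕ) : ℝ := ahead ω n i + residual ω n i

/-- Service received by customer `i` in period `n`. -/
noncomputable def served (ω : Input) (n i : ℕ) : ℝ :=
  min (residual ω n i) (max 0 (gap ω n - ahead ω n i))

lemma backlog_nonneg (hω : ∀ n, 0 ≤ gap ω n ∧ 0 ≤ service ω n) (n i : ℕ) : 0 ≤ backlog ω n i :=
  add_nonneg (ahead_nonneg hω n i) (residual_nonneg hω n i)

/-- As long as `i` is unfinished, the server spends the whole gap on his backlog. -/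
lemma backlog_succ (hω : ∀ n, 0 ≤ gap ω n ∧ 0 ≤ service ω n) {i n : ℕ} (hin : i ≤ n)
    (h : gap ω n < backlog ω n i) :
    backlog ω (n + 1) i
      = backlog ω n i - gap ω n + overtake (premium ω i) (ω (n + 1)).2 := by
  rw [backlog] at h
  rw [backlog, backlog, ahead_succ hω hin, residual_succ_of_ne (by omega)]
  have := residual_nonneg hω n i
  rcases le_total (gap ω n) (ahead ω n i) with h' | h'
  · rw [max_eq_right (by linarith), max_eq_left (by linarith), min_eq_right this]
    ring
  · rw [max_eq_left (by linarith), max_eq_right (by linarith), min_eq_right (by linarith)]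
    ring

lemma served_nonneg (hω : ∀ n, 0 ≤ gap ω n ∧ 0 ≤ service ω n) (n i : ℕ) : 0 ≤ served ω n i :=
  le_min (residual_nonneg hω n i) (le_max_left _ _)

lemma min_gap_backlog (hω : ∀ n, 0 ≤ gap ω n ∧ 0 ≤ service ω n) (n i : ℕ) :
    min (gap ω n) (backlog ω n i) = min (gap ω n) (ahead ω n i) + served ω n i := by
  rw [backlog, served]
  have := residual_nonneg hω n i
  rcases le_total (gap ω n) (ahead ω n i) with h | h
  · rw [min_eq_left h, max_eq_left (by linarith), min_eq_right this, min_eq_left (by linarith),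
      add_zero]
  · rw [min_eq_right h, max_eq_right (by linarith)]
    rcases le_total (residual ω n i) (gap ω n - ahead ω n i) with h' | h'
    · rw [min_eq_left h', min_eq_right (by linarith)]
    · rw [min_eq_right h', min_eq_left (by linarith)]
      ring

lemma inSystem_self (i : ℕ) : InSystem ω i i := ⟨le_rfl, fun m h h' => absurd h' (by omega)⟩

lemma inSystem_succ {i n : ℕ} (hin : i ≤ n) :
    InSystem ω i (n + 1) ↔ InSystem ω i n ∧ gap ω n < backlog ω n i := by
  constructor
  · exact fun h => ⟨⟨hin, fun m h1 h2 => h.2 m h1 (by omega)⟩, h.2 n hin (by omega)⟩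
  · rintro ⟨h, h'⟩
    refine ⟨by omega, fun m h1 h2 => ?_⟩
    rcases Nat.lt_succ_iff_lt_or_eq.mp h2 with h3 | rfl
    · exact h.2 m h1 h3
    · exact h'

lemma served_eq_residual {n i : ℕ} (h : backlog ω n i ≤ gap ω n) :
    0 ≤ residual ω n i → served ω n i = residual ω n i := by
  rw [backlog] at h
  exact fun _ => min_eq_left (le_max_of_le_right (by linarith))

end

/-! ### Dependence on the past only, and measurability -/

section congr

variable {ω ω' : Input} {n : ℕ}

/-- The state at the start of period `n` involves gaps strictly before `n` but marks up to `n`. This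
offset is what makes gap `n` and mark `n + 1` fresh. -/
lemma residual_congr (hgap : ∀ m < n, gap ω m = gap ω' m) (hmark : ∀ m ≤ n, (ω m).2 = (ω' m).2) :
    ∀ m ≤ n, residual ω m = residual ω' m := by
  intro m
  induction m with
  | zero =>
    intro h
    funext j
    simp only [residual, service, hmark 0 h]
  | succ m ih =>
    intro h
    have ihm := ih (by omega)
    funext j
    simp only [residual]
    split_ifs with hj
    · simp only [service, hmark _ h]
    · by_cases hjm : j ≤ m
      · have hw : workAhead ω m (residual ω m) j = workAhead ω' m (residual ω' m) j := by
          rw [workAhead, workAhead, ihm]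
          congr 1
          refine Finset.filter_congr fun k hk => ?_
          have hk' : k ≤ m := by simpa [Nat.lt_succ_iff] using hk
          simp only [Precedes, premium, hmark k (by omega), hmark j (by omega)]
        rw [hw, ihm, hgap m (by omega)]
      · have hz : ∀ (ω : Input) (l : ℕ), ∀ j, l < j → residual ω l j = 0 := by
          intro ω l
          induction l with
          | zero => intro j hj; simp [residual, hj.ne']
          | succ l ih' =>
            intro j hj
            rw [residual_succ_of_ne (by omega), ih' j (by omega)]
            simp
        rw [hz ω m j (by omega), hz ω' m j (by omega)]
        simp

lemma ahead_congr (hgap : ∀ m < n, gap ω m = gap ω' m) (hmark : ∀ m ≤ n, (ω m).2 = (ω' m).2)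
    {m i : ℕ} (hm : m ≤ n) (hi : i ≤ n) : ahead ω m i = ahead ω' m i := by
  rw [ahead, ahead, workAhead, workAhead, residual_congr hgap hmark m hm]
  congr 1
  refine Finset.filter_congr fun k hk => ?_
  have hk' : k ≤ m := by simpa [Nat.lt_succ_iff] using hk
  simp only [Precedes, premium, hmark k (by omega), hmark i hi]

lemma backlog_congr (hgap : ∀ m < n, gap ω m = gap ω' m) (hmark : ∀ m ≤ n, (ω m).2 = (ω' m).2)
    {m i : ℕ} (hm : m ≤ n) (hi : i ≤ n) : backlog ω m i = backlog ω' m i := by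
  rw [backlog, backlog, ahead_congr hgap hmark hm hi, residual_congr hgap hmark m hm]

lemma inSystem_congr (hgap : ∀ m < n, gap ω m = gap ω' m)
    (hmark : ∀ m ≤ n, (ω m).2 = (ω' m).2) {i : ℕ} (hi : i ≤ n) :
    InSystem ω i n ↔ InSystem ω' i n := by
  refine and_congr_right fun _ => forall_congr' fun m => forall_congr' fun _ =>
    forall_congr' fun hmn => ?_
  have := backlog_congr hgap hmark hmn.le hi
  rw [backlog, backlog] at this
  rw [this, hgap m hmn]

lemma found_congr {c : Bool} (h : ∀ m < n, ω m = ω' m) : found ω c n = found ω' c n := by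
  induction n with
  | zero => rfl
  | succ n ih => rw [found, found, ih fun m hm => h m (by omega), gap, gap, h n (by omega)]

end congr

section measurability

lemma measurable_gap (n : ℕ) : Measurable fun ω : Input => gap ω n := by
  unfold gap; fun_prop

lemma measurable_service (n : ℕ) : Measurable fun ω : Input => service ω n := by
  unfold service; fun_prop

lemma measurable_premium (n : ℕ) : Measurable fun ω : Input => premium ω n := by
  unfold premium; fun_prop

lemma measurableSet_premium_eq (n : ℕ) (c : Bool) : MeasurableSet {ω : Input | premium ω n = c} :=
  measurable_premium n (measurableSet_singleton c)

lemma measurableSet_precedes (j i : ℕ) : MeasurableSet {ω : Input | Precedes ω j i} :=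
  ((measurableSet_premium_eq j true).inter (measurableSet_premium_eq i false)).union
    ((measurableSet_eq_fun (measurable_premium j) (measurable_premium i)).inter
      (MeasurableSet.const _))

lemma measurable_ahead_of {n : ℕ} (h : ∀ j, Measurable fun ω : Input => residual ω n j) (i : ℕ) :
    Measurable fun ω : Input => ahead ω n i := by
  simp only [ahead, workAhead, Finset.sum_filter]
  exact Finset.measurable_fun_sum _ fun j _ =>
    Measurable.ite (measurableSet_precedes j i) (h j) measurable_const

lemma measurable_residual (n : ℕ) : ∀ j, Measurable fun ω : Input => residual ω n j := by
  induction n with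
  | zero =>
    intro j
    simp only [residual]
    split_ifs
    exacts [measurable_service 0, measurable_const]
  | succ n ih =>
    intro j
    by_cases h : j = n + 1
    · simp only [h, residual_self]
      exact measurable_service _
    · simp only [residual_succ_of_ne h]
      exact (ih j).sub ((ih j).min (measurable_const.max
        ((measurable_gap n).sub (measurable_ahead_of ih j))))

lemma measurable_ahead (n i : ℕ) : Measurable fun ω : Input => ahead ω n i :=
  measurable_ahead_of (measurable_residual n) i

lemma measurable_backlog (n i : ℕ) : Measurable fun ω : Input => backlog ω n i :=
  (measurable_ahead n i).add (measurable_residual n i)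

lemma measurable_served (n i : ℕ) : Measurable fun ω : Input => served ω n i :=
  (measurable_residual n i).min
    (measurable_const.max ((measurable_gap n).sub (measurable_ahead n i)))

lemma measurableSet_inSystem (i n : ℕ) : MeasurableSet {ω : Input | InSystem ω i n} := by
  have : {ω : Input | InSystem ω i n}
      = {_ω | i ≤ n} ∩ ⋂ m, ⋂ (_ : i ≤ m), ⋂ (_ : m < n), {ω | gap ω m < backlog ω m i} := by
    ext ω
    simp only [InSystem, backlog, Set.mem_ofPred_eq, Set.mem_inter_iff, Set.mem_iInter]
  rw [this]
  exact (MeasurableSet.const _).inter <| MeasurableSet.iInter fun m => MeasurableSet.iInter fun _ =>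
    MeasurableSet.iInter fun _ => measurableSet_lt (measurable_gap m) (measurable_backlog m i)

lemma measurable_load (c : Bool) : Measurable (load c) :=
  Measurable.ite ((MeasurableSet.const _).union (measurable_snd (measurableSet_singleton true)))
    measurable_fst measurable_const

lemma measurable_overtake (c : Bool) : Measurable (overtake c) :=
  Measurable.ite ((measurable_snd (measurableSet_singleton true)).inter (MeasurableSet.const _))
    measurable_fst measurable_const

lemma measurable_found (c : Bool) (n : ℕ) : Measurable fun ω : Input => found ω c n := by
  induction n with
  | zero => exact measurable_const
  | succ n ih =>
    simp only [found]
    exact measurable_const.max ((ih.add ((measurable_load c).comp (by fun_prop))).sub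
      (measurable_gap n))

end measurability

/-! ### Laws of the work found and of the backlog -/

section

variable {lam : ℝ} {G : Measure ℝ} {φ : I}

/-- Law of the work that a customer brings for later arrivals of class `c`. -/
noncomputable def loadLaw (G : Measure ℝ) (φ : I) (c : Bool) : Measure ℝ :=
  (markLaw G φ).map (load c)

/-- Law of the work that a customer brings for earlier arrivals of class `c`. -/
noncomputable def overtakeLaw (G : Measure ℝ) (φ : I) (c : Bool) : Measure ℝ :=
  (markLaw G φ).map (overtake c)

lemma isProbabilityMeasure_loadLaw [IsProbabilityMeasure G] (c : Bool) :
    IsProbabilityMeasure (loadLaw G φ c) :=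
  Measure.isProbabilityMeasure_map (measurable_load c).aemeasurable

lemma isProbabilityMeasure_overtakeLaw [IsProbabilityMeasure G] (c : Bool) :
    IsProbabilityMeasure (overtakeLaw G φ c) :=
  Measure.isProbabilityMeasure_map (measurable_overtake c).aemeasurable

lemma ae_nonneg_markLaw (hG : ∀ᵐ s ∂G, 0 ≤ s) [IsProbabilityMeasure G] :
    ∀ᵐ y ∂(markLaw G φ), 0 ≤ y.1 :=
  Measure.quasiMeasurePreserving_fst.ae hG

lemma ae_nonneg_loadLaw (hG : ∀ᵐ s ∂G, 0 ≤ s) [IsProbabilityMeasure G] (c : Bool) :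
    ∀ᵐ b ∂(loadLaw G φ c), 0 ≤ b := by
  refine (ae_map_iff (measurable_load c).aemeasurable measurableSet_Ici).mpr ?_
  filter_upwards [ae_nonneg_markLaw hG] with y hy
  rw [load]
  split_ifs
  exacts [hy, le_rfl]

lemma ae_nonneg_overtakeLaw (hG : ∀ᵐ s ∂G, 0 ≤ s) [IsProbabilityMeasure G] (c : Bool) :
    ∀ᵐ b ∂(overtakeLaw G φ c), 0 ≤ b := by
  refine (ae_map_iff (measurable_overtake c).aemeasurable measurableSet_Ici).mpr ?_
  filter_upwards [ae_nonneg_markLaw hG] with y hy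
  rw [overtake]
  split_ifs
  exacts [hy, le_rfl]

lemma found_update_self (ω : Input) (c : Bool) (n : ℕ) (x : ℝ × ℝ × Bool) :
    found (Function.update ω n x) c n = found ω c n :=
  found_congr fun _ hm => Function.update_of_ne hm.ne _ _

/-- The work found by the `n`-th customer obeys Lindley's recursion. -/
lemma lintegral_found (hlam : 0 < lam) [IsProbabilityMeasure G] (c : Bool) (n : ℕ) :
    ∀ {g : ℝ → ℝ≥0∞}, Measurable g →
      ∫⁻ ω, g (found ω c n) ∂(inputLaw lam G φ)
        = ∫⁻ x, g x ∂(lindleyLaw lam (loadLaw G φ c) n) := by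
  have := isProbabilityMeasure_expMeasure hlam
  have := isProbabilityMeasure_loadLaw (G := G) (φ := φ) c
  have := isProbabilityMeasure_inputLaw (G := G) (φ := φ) hlam
  induction n with
  | zero =>
    intro g hg
    simp [found, lindleyLaw, lintegral_dirac' _ hg]
  | succ n ih =>
    intro g hg
    have hm : Measurable fun p : (ℝ × ℝ) × ℝ => g (max 0 (p.1.1 + p.1.2 - p.2)) :=
      hg.comp (by fun_prop)
    have hm2 : Measurable fun p : ℝ × ℝ =>
        ∫⁻ a, g (max 0 (p.1 + p.2 - a)) ∂(expMeasure lam) := hm.lintegral_prod_right'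
    rw [lintegral_lindleyLaw_succ hlam n hg, ← ih hm2.lintegral_prod_right',
      lintegral_resample (F := fun ω => g (found ω c (n + 1))) hlam n
        (hg.comp (measurable_found c (n + 1)))]
    refine lintegral_congr fun ω => ?_
    have hm3 : Measurable fun b => ∫⁻ a, g (max 0 (found ω c n + b - a)) ∂(expMeasure lam) :=
      hm2.comp measurable_prodMk_left
    rw [loadLaw, lintegral_map hm3 (measurable_load c)]
    simp only [found, found_update_self, gap, Function.update_self]

/-- The realizations for which customer `i` is of class `c` and in the system at the start of
period `n`. -/
def present (i : ℕ) (c : Bool) (n : ℕ) : Set Input := {ω | premium ω i = c ∧ InSystem ω i n}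

lemma measurableSet_present (i : ℕ) (c : Bool) (n : ℕ) : MeasurableSet (present i c n) :=
  (measurableSet_premium_eq i c).inter (measurableSet_inSystem i n)

lemma present_congr {ω ω' : Input} {n i : ℕ} (c : Bool) (hgap : ∀ m < n, gap ω m = gap ω' m)
    (hmark : ∀ m ≤ n, (ω m).2 = (ω' m).2) (hi : i ≤ n) :
    ω ∈ present i c n ↔ ω' ∈ present i c n :=
  and_congr (by rw [premium, premium, hmark i hi]) (inSystem_congr hgap hmark hi)

/-- Expectation of `g` of the backlog of a customer after one period, on the event that he is then
still in the system. -/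
noncomputable def transition (lam : ℝ) (ν : Measure ℝ) (g : ℝ → ℝ≥0∞) (r : ℝ) : ℝ≥0∞ :=
  ∫⁻ a, (if a < r then ∫⁻ b, g (r - a + b) ∂ν else 0) ∂(expMeasure lam)

lemma gap_update_of_lt (ω : Input) (n : ℕ) (x : ℝ × ℝ × Bool) :
    ∀ m < n, gap (Function.update ω n x) m = gap ω m := fun m hm => by
  rw [gap, gap, Function.update_of_ne hm.ne]

lemma mark_update_gap (ω : Input) (n : ℕ) (a : ℝ) (m : ℕ) :
    (Function.update ω n (a, (ω n).2) m).2 = (ω m).2 := by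
  by_cases h : m = n
  · subst h; simp
  · rw [Function.update_of_ne h]

/-- Presence and backlog at the start of period `n` do not involve gap `n`, which is therefore an
independent exponential. -/
lemma lintegral_present_resample_gap (hlam : 0 < lam) [IsProbabilityMeasure G] {i n : ℕ}
    (hin : i ≤ n) (c : Bool) {f : ℝ → ℝ → ℝ≥0∞} (hf : Measurable (Function.uncurry f)) :
    ∫⁻ ω in present i c n, f (backlog ω n i) (gap ω n) ∂(inputLaw lam G φ)
      = ∫⁻ ω in present i c n, ∫⁻ a, f (backlog ω n i) a ∂(expMeasure lam)
          ∂(inputLaw lam G φ) := by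
  have hm : Measurable fun ω : Input => f (backlog ω n i) (gap ω n) :=
    hf.comp ((measurable_backlog n i).prodMk (measurable_gap n))
  rw [← lintegral_indicator (measurableSet_present i c n),
    ← lintegral_indicator (measurableSet_present i c n),
    lintegral_resample_gap hlam n (hm.indicator (measurableSet_present i c n))]
  refine lintegral_congr fun ω => ?_
  have h1 := fun a => present_congr (i := i) c (gap_update_of_lt ω n (a, (ω n).2))
    (fun m _ => mark_update_gap ω n a m) hin
  have h2 := fun a => backlog_congr (i := i) (gap_update_of_lt ω n (a, (ω n).2))
    (fun m _ => mark_update_gap ω n a m) le_rfl hin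
  by_cases h : ω ∈ present i c n
  · simp only [Set.indicator_of_mem h, Set.indicator_of_mem ((h1 _).mpr h), h2]
    simp only [gap, Function.update_self]
  · simp only [Set.indicator_of_notMem h, Set.indicator_of_notMem fun h' => h ((h1 _).mp h'),
      lintegral_zero]

/-- Markov property of the backlog, killed at departure: the gap decides survival and the mark of
the next arrival gives the jump; both are independent of the past. -/
lemma lintegral_present_succ (hlam : 0 < lam) [IsProbabilityMeasure G] (hG : ∀ᵐ s ∂G, 0 ≤ s)
    {i n : ℕ} (hin : i ≤ n) (c : Bool) {g : ℝ → ℝ≥0∞} (hg : Measurable g) :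
    ∫⁻ ω in present i c (n + 1), g (backlog ω (n + 1) i) ∂(inputLaw lam G φ)
      = ∫⁻ ω in present i c n, transition lam (overtakeLaw G φ c) g (backlog ω n i)
          ∂(inputLaw lam G φ) := by
  have := isProbabilityMeasure_overtakeLaw (G := G) (φ := φ) c
  set f : ℝ → ℝ → ℝ≥0∞ := fun r a =>
    if a < r then ∫⁻ b, g (r - a + b) ∂(overtakeLaw G φ c) else 0 with hf
  have hfm : Measurable (Function.uncurry f) := by
    refine Measurable.ite (measurableSet_lt measurable_snd measurable_fst) ?_ measurable_const
    exact Measurable.lintegral_prod_right'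
      (f := fun p : (ℝ × ℝ) × ℝ => g (p.1.1 - p.1.2 + p.2)) (hg.comp (by fun_prop))
  have hres := lintegral_present_resample_gap (G := G) (φ := φ) hlam hin c hfm
  simp only [transition]
  refine Eq.trans ?_ hres
  rw [← lintegral_indicator (measurableSet_present i c n),
    ← lintegral_indicator (measurableSet_present i c (n + 1))]
  have hset : MeasurableSet {ω : Input | ω ∈ present i c n ∧ gap ω n < backlog ω n i} :=
    (measurableSet_present i c n).inter
      (measurableSet_lt (measurable_gap n) (measurable_backlog n i))
  have hFm : Measurable fun ω : Input =>
      Set.indicator {ω : Input | ω ∈ present i c n ∧ gap ω n < backlog ω n i}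
        (fun ω => g (backlog ω n i - gap ω n + overtake c (ω (n + 1)).2)) ω := by
    refine Measurable.indicator (hg.comp ?_) hset
    exact ((measurable_backlog n i).sub (measurable_gap n)).add
      ((measurable_overtake c).comp (by fun_prop))
  calc _ = ∫⁻ ω, Set.indicator {ω : Input | ω ∈ present i c n ∧ gap ω n < backlog ω n i}
        (fun ω => g (backlog ω n i - gap ω n + overtake c (ω (n + 1)).2)) ω
          ∂(inputLaw lam G φ) := by
        refine lintegral_congr_ae ?_
        filter_upwards [ae_inputLaw hlam hG] with ω hω
        have hiff : ω ∈ present i c (n + 1) ↔ ω ∈ present i c n ∧ gap ω n < backlog ω n i := by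
          change _ ∧ _ ↔ (_ ∧ _) ∧ _
          rw [inSystem_succ hin, and_assoc]
        by_cases h : ω ∈ present i c n ∧ gap ω n < backlog ω n i
        · rw [Set.indicator_of_mem (hiff.mpr h), Set.indicator_of_mem (by exact h),
            backlog_succ hω hin h.2, h.1.1]
        · rw [Set.indicator_of_notMem fun h' => h (hiff.mp h'),
            Set.indicator_of_notMem (by exact h)]
    _ = _ := by
        rw [lintegral_resample_mark hlam (n + 1) hFm]
        refine lintegral_congr fun ω => ?_
        have hg' : ∀ y, gap (Function.update ω (n + 1) ((ω (n + 1)).1, y)) n = gap ω n := fun y =>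
          gap_update_of_lt ω (n + 1) _ n (by omega)
        have hmk : ∀ y, ∀ m ≤ n,
            (Function.update ω (n + 1) ((ω (n + 1)).1, y) m).2 = (ω m).2 := fun y m hm => by
          rw [Function.update_of_ne (by omega)]
        have h1 := fun y => present_congr (i := i) c
          (fun m hm => gap_update_of_lt ω (n + 1) ((ω (n + 1)).1, y) m (by omega)) (hmk y) hin
        have h2 := fun y => backlog_congr (i := i)
          (fun m hm => gap_update_of_lt ω (n + 1) ((ω (n + 1)).1, y) m (by omega)) (hmk y)
          le_rfl hin
        have h3 : ∀ y, Function.update ω (n + 1) ((ω (n + 1)).1, y)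
            ∈ {ω : Input | ω ∈ present i c n ∧ gap ω n < backlog ω n i}
            ↔ (ω ∈ present i c n ∧ gap ω n < backlog ω n i) := fun y =>
          and_congr (h1 y) (by rw [hg', h2])
        by_cases h : ω ∈ present i c n
        · rw [Set.indicator_of_mem h, hf]
          dsimp only
          split_ifs with hlt
          · simp only [Set.indicator_of_mem ((h3 _).mpr ⟨h, hlt⟩), hg', h2, Function.update_self]
            rw [overtakeLaw, lintegral_map (by fun_prop) (measurable_overtake c)]
          · simp only [Set.indicator_of_notMem fun h' => hlt ((h3 _).mp h').2, lintegral_zero]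
        · simp only [Set.indicator_of_notMem h,
            Set.indicator_of_notMem fun h' => h ((h3 _).mp h').1, lintegral_zero]

end

/-! ### Drift of the backlog -/

section

variable {lam : ℝ} {ν : Measure ℝ} [IsProbabilityMeasure ν]

lemma transition_ofReal (hν : ∀ᵐ b ∂ν, 0 ≤ b) (r : ℝ) :
    transition lam ν (fun x => ENNReal.ofReal x) r
      = overshoot lam 1 r + powMoment ν 1 * overshoot lam 0 r := by
  have hm : ∀ k, Measurable fun a : ℝ => if a < r then ENNReal.ofReal ((r - a) ^ k) else 0 :=
    fun k => (measurable_overshoot_integrand k).comp (measurable_const.prodMk measurable_id)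
  rw [overshoot, overshoot, ← lintegral_const_mul _ (hm 0), ← lintegral_add_left (hm 1)]
  refine lintegral_congr fun a => ?_
  split_ifs with h
  · have : ∀ᵐ b ∂ν, ENNReal.ofReal (r - a + b)
        = ENNReal.ofReal (r - a) + ENNReal.ofReal b ^ 1 := by
      filter_upwards [hν] with b hb
      rw [ENNReal.ofReal_add (by linarith) hb, pow_one]
    rw [lintegral_congr_ae this, lintegral_add_left measurable_const, lintegral_const,
      measure_univ]
    simp [powMoment]
  · simp

lemma transition_ofReal_sq (hν : ∀ᵐ b ∂ν, 0 ≤ b) (r : ℝ) :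
    transition lam ν (fun x => ENNReal.ofReal x ^ 2) r
      = overshoot lam 2 r + 2 * powMoment ν 1 * overshoot lam 1 r
        + powMoment ν 2 * overshoot lam 0 r := by
  have hm : ∀ k, Measurable fun a : ℝ => if a < r then ENNReal.ofReal ((r - a) ^ k) else 0 :=
    fun k => (measurable_overshoot_integrand k).comp (measurable_const.prodMk measurable_id)
  rw [overshoot, overshoot, overshoot, ← lintegral_const_mul _ (hm 0),
    ← lintegral_const_mul _ (hm 1), ← lintegral_add_left (hm 2),
    ← lintegral_add_right _ ((hm 0).const_mul _)]
  refine lintegral_congr fun a => ?_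
  split_ifs with h
  · have : ∀ᵐ b ∂ν, ENNReal.ofReal (r - a + b) ^ 2
        = ENNReal.ofReal (r - a) ^ 2 + 2 * ENNReal.ofReal (r - a) * ENNReal.ofReal b ^ 1
          + ENNReal.ofReal b ^ 2 := by
      filter_upwards [hν] with b hb
      rw [ENNReal.ofReal_add (by linarith) hb]
      ring
    rw [lintegral_congr_ae this, lintegral_add_left (by fun_prop),
      lintegral_add_left (by fun_prop), lintegral_const_mul _ (by fun_prop), lintegral_const,
      measure_univ, ENNReal.ofReal_pow (by linarith), powMoment, powMoment]
    simp only [pow_zero, pow_one, ENNReal.ofReal_one, mul_one]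
    ring
  · simp

lemma transition_add_const_mul {f g : ℝ → ℝ≥0∞} (hf : Measurable f) (hg : Measurable g)
    (κ : ℝ≥0∞) (r : ℝ) :
    transition lam ν (fun x => f x + κ * g x) r
      = transition lam ν f r + κ * transition lam ν g r := by
  have hm : ∀ {h : ℝ → ℝ≥0∞}, Measurable h →
      Measurable fun a : ℝ => if a < r then ∫⁻ b, h (r - a + b) ∂ν else 0 := fun hh =>
    Measurable.ite measurableSet_Iio (Measurable.lintegral_prod_right'
      (f := fun p : ℝ × ℝ => _) (hh.comp (by fun_prop : Measurable fun p : ℝ × ℝ =>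
        r - p.1 + p.2))) measurable_const
  rw [transition, transition, transition, ← lintegral_const_mul _ (hm hg),
    ← lintegral_add_left (hm hf)]
  refine lintegral_congr fun a => ?_
  split_ifs
  · rw [lintegral_add_left (by fun_prop), lintegral_const_mul _ (by fun_prop)]
  · simp

variable {δ : ℝ≥0∞}

/-- Here `δ` stands for `1/lam` minus the mean jump: on `A < r` a jump occurs and gives back part of
the mean loss `P(A < r) / lam`. -/
lemma ofReal_eq_transition_add (hlam : 0 < lam) (hν : ∀ᵐ b ∂ν, 0 ≤ b)
    (hδ : ENNReal.ofReal (1 / lam) = powMoment ν 1 + δ) {r : ℝ} (hr : 0 ≤ r) :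
    ENNReal.ofReal r
      = transition lam ν (fun x => ENNReal.ofReal x) r + δ * overshoot lam 0 r := by
  have h := overshoot_succ_add hlam 0 hr
  simp only [Nat.cast_zero, zero_add, pow_one] at h
  rw [← h, hδ, transition_ofReal hν]
  ring

/-- A quadratic function of the backlog whose mean decreases, while the customer is in the system,
by a multiple of the mean backlog. -/
lemma sq_add_eq_transition_add (hlam : 0 < lam) (hν : ∀ᵐ b ∂ν, 0 ≤ b)
    (hδ : ENNReal.ofReal (1 / lam) = powMoment ν 1 + δ) {κ : ℝ≥0∞}
    (hκ : κ * δ = powMoment ν 2 + 2 * δ * ENNReal.ofReal (1 / lam)) {r : ℝ} (hr : 0 ≤ r) :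
    ENNReal.ofReal r ^ 2 + κ * ENNReal.ofReal r
      = transition lam ν (fun x => ENNReal.ofReal x ^ 2 + κ * ENNReal.ofReal x) r
        + 2 * δ * ENNReal.ofReal r := by
  have h1 := overshoot_succ_add hlam 0 hr
  have h2 := overshoot_succ_add hlam 1 hr
  have e2 : ENNReal.ofReal ((1 + 1) / lam) = 2 * ENNReal.ofReal (1 / lam) := by
    rw [show (1 + 1) / lam = 2 * (1 / lam) by ring, ENNReal.ofReal_mul (by norm_num)]
    simp
  simp only [Nat.cast_zero, zero_add, pow_one, Nat.cast_one, Nat.reduceAdd] at h1 h2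
  rw [transition_add_const_mul (by fun_prop) (by fun_prop), transition_ofReal hν,
    transition_ofReal_sq hν, ← ENNReal.ofReal_pow hr, ← h1, ← h2, e2]
  -- The linear term loses `κ * δ` times `overshoot lam 0 r`. The choice of `κ` makes this cover the
  -- second moment of the jump, which the square gains, and the multiple of `overshoot lam 0 r`
  -- contained in `2 * δ * r`.
  have : κ * (overshoot lam 1 r + ENNReal.ofReal (1 / lam) * overshoot lam 0 r)
      = κ * (overshoot lam 1 r + powMoment ν 1 * overshoot lam 0 r)
        + (κ * δ) * overshoot lam 0 r := by
    rw [hδ]; ring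
  rw [this, hκ]
  have e3 : 2 * ENNReal.ofReal (1 / lam) * overshoot lam 1 r
      = 2 * powMoment ν 1 * overshoot lam 1 r + 2 * δ * overshoot lam 1 r := by
    rw [hδ]; ring
  rw [e3]
  ring

end

/-! ### Telescoping and the mean sojourn time -/

lemma eq_add_sum_of_succ {u v : ℕ → ℝ≥0∞} (h : ∀ k, u k = u (k + 1) + v k) (N : ℕ) :
    u 0 = u N + ∑ k ∈ Finset.range N, v k := by
  induction N with
  | zero => simp
  | succ N ih => rw [ih, h N, Finset.sum_range_succ]; ring

lemma tsum_le_of_succ {u v : ℕ → ℝ≥0∞} (h : ∀ k, u k = u (k + 1) + v k) : ∑' k, v k ≤ u 0 := by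
  rw [ENNReal.tsum_eq_iSup_nat]
  exact iSup_le fun N => (eq_add_sum_of_succ h N).symm ▸ le_add_self

lemma eq_tsum_of_succ {u v : ℕ → ℝ≥0∞} (h : ∀ k, u k = u (k + 1) + v k)
    (h0 : Tendsto u atTop (𝓝 0)) : u 0 = ∑' k, v k := by
  have hlim := h0.add (ENNReal.tendsto_nat_tsum v)
  rw [zero_add] at hlim
  exact tendsto_nhds_unique
    (tendsto_const_nhds.congr fun N => eq_add_sum_of_succ h N) hlim

lemma present_self (i : ℕ) (c : Bool) : present i c i = {ω | premium ω i = c} := by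
  ext ω
  exact and_iff_left (inSystem_self i)

section

variable {lam : ℝ} {G : Measure ℝ} {φ : I}

lemma lintegral_wait (i : ℕ) (c : Bool) :
    ∫⁻ ω in {ω | premium ω i = c}, wait ω i ∂(inputLaw lam G φ)
      = ∑' k, ∫⁻ ω in present i c (k + i), ENNReal.ofReal (min (gap ω (k + i)) (ahead ω (k + i) i))
          ∂(inputLaw lam G φ) := by
  have hfm : ∀ n, Measurable fun ω : Input => ENNReal.ofReal (min (gap ω n) (ahead ω n i)) :=
    fun n => ((measurable_gap n).min (measurable_ahead n i)).ennreal_ofReal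
  have e1 : ∀ ω, wait ω i = ∑' n, Set.indicator {ω | InSystem ω i n}
      (fun ω => ENNReal.ofReal (min (gap ω n) (ahead ω n i))) ω := fun ω => by
    rw [wait]
    refine tsum_congr fun n => ?_
    by_cases h : InSystem ω i n
    · rw [Set.indicator_of_mem (by exact h), Set.indicator_of_mem (by exact h)]
    · rw [Set.indicator_of_notMem (by exact h), Set.indicator_of_notMem (by exact h)]
  have hmem : ∀ n, (∫⁻ ω in {ω | premium ω i = c}, Set.indicator {ω | InSystem ω i n}
      (fun ω => ENNReal.ofReal (min (gap ω n) (ahead ω n i))) ω ∂(inputLaw lam G φ))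
      = ∫⁻ ω in present i c n, ENNReal.ofReal (min (gap ω n) (ahead ω n i))
          ∂(inputLaw lam G φ) := fun n => by
    have hset : {ω : Input | InSystem ω i n} ∩ {ω | premium ω i = c} = present i c n :=
      Set.inter_comm _ _
    rw [setLIntegral_indicator (measurableSet_inSystem i n), hset]
  rw [lintegral_congr e1,
    lintegral_tsum fun n => ((hfm n).indicator (measurableSet_inSystem i n)).aemeasurable,
    tsum_congr hmem, ← Summable.sum_add_tsum_nat_add' (k := i) ENNReal.summable,
    Finset.sum_eq_zero, zero_add]
  intro n hn
  have : present i c n = ∅ := by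
    ext ω
    simp only [Set.mem_empty_iff_false, iff_false]
    exact fun h => absurd h.2.1 (not_le.mpr (Finset.mem_range.mp hn))
  rw [this, setLIntegral_empty]

/-- Mean-value balance for the waiting time of a customer: his mean sojourn time is proportional to
the mean backlog he finds, his own service included. -/
theorem wait_balance (hlam : 0 < lam) [IsProbabilityMeasure G] (hG : ∀ᵐ s ∂G, 0 ≤ s)
    (i : ℕ) (c : Bool) (h2 : powMoment (overtakeLaw G φ c) 2 ≠ ∞) {δ : ℝ≥0∞} (hδ0 : δ ≠ 0)
    (hδ : ENNReal.ofReal (1 / lam) = powMoment (overtakeLaw G φ c) 1 + δ)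
    (hfin : ∫⁻ ω, ENNReal.ofReal (backlog ω i i) ^ 2 ∂(inputLaw lam G φ) ≠ ∞) :
    δ * (∫⁻ ω in {ω | premium ω i = c}, wait ω i ∂(inputLaw lam G φ)
        + ∫⁻ ω in {ω | premium ω i = c}, ENNReal.ofReal (service ω i) ∂(inputLaw lam G φ))
      = ENNReal.ofReal (1 / lam)
        * ∫⁻ ω in {ω | premium ω i = c}, ENNReal.ofReal (backlog ω i i) ∂(inputLaw lam G φ) := by
  have := isProbabilityMeasure_inputLaw (G := G) (φ := φ) hlam
  have := isProbabilityMeasure_overtakeLaw (G := G) (φ := φ) c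
  have hν := ae_nonneg_overtakeLaw (φ := φ) hG c
  have hδt : δ ≠ ∞ := ne_top_of_le_ne_top ENNReal.ofReal_ne_top (hδ ▸ le_add_self)
  have hω : ∀ s : Set Input, ∀ᵐ ω ∂((inputLaw lam G φ).restrict s),
      ∀ n, 0 ≤ gap ω n ∧ 0 ≤ service ω n := fun s => ae_restrict_of_ae (ae_inputLaw hlam hG)
  set κ : ℝ≥0∞ := (powMoment (overtakeLaw G φ c) 2 + 2 * δ * ENNReal.ofReal (1 / lam)) / δ with hκd
  have hκ : κ * δ = powMoment (overtakeLaw G φ c) 2 + 2 * δ * ENNReal.ofReal (1 / lam) :=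
    ENNReal.div_mul_cancel hδ0 hδt
  have hκt : κ ≠ ∞ := ENNReal.div_ne_top (by finiteness) hδ0
  have hbm := fun n => measurable_backlog n i
  set e : ℕ → ℝ≥0∞ := fun k => ∫⁻ ω in present i c (k + i),
    ENNReal.ofReal (backlog ω (k + i) i) ∂(inputLaw lam G φ) with he
  set z : ℕ → ℝ≥0∞ := fun k => ∫⁻ ω in present i c (k + i),
    overshoot lam 0 (backlog ω (k + i) i) ∂(inputLaw lam G φ) with hz
  set q : ℕ → ℝ≥0∞ := fun k => ∫⁻ ω in present i c (k + i),
    (ENNReal.ofReal (backlog ω (k + i) i) ^ 2 + κ * ENNReal.ofReal (backlog ω (k + i) i))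
      ∂(inputLaw lam G φ) with hq
  set d : ℕ → ℝ≥0∞ := fun k => ∫⁻ ω in present i c (k + i),
    ENNReal.ofReal (residual ω (k + i) i) ∂(inputLaw lam G φ) with hd
  set s : ℕ → ℝ≥0∞ := fun k => ∫⁻ ω in present i c (k + i),
    ENNReal.ofReal (served ω (k + i) i) ∂(inputLaw lam G φ) with hs
  set w : ℕ → ℝ≥0∞ := fun k => ∫⁻ ω in present i c (k + i),
    ENNReal.ofReal (min (gap ω (k + i)) (ahead ω (k + i) i)) ∂(inputLaw lam G φ) with hw
  have hkey : ∀ k, k + 1 + i = k + i + 1 := fun k => by omega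
  -- Four one-step relations follow: for the mean backlog `e`, its quadratic function `q`, the
  -- remaining service `d`, and the time `w + s` spent in the system during a period.
  have he_succ : ∀ k, e k = e (k + 1) + δ * z k := by
    intro k
    have hm : Measurable fun ω : Input => overshoot lam 0 (backlog ω (k + i) i) :=
      (measurable_overshoot hlam 0).comp (hbm _)
    simp only [he, hz]
    rw [hkey, lintegral_present_succ hlam hG (by omega) c (g := fun x => ENNReal.ofReal x)
      (by fun_prop), ← lintegral_const_mul _ hm, ← lintegral_add_right _ (hm.const_mul _)]
    refine lintegral_congr_ae ?_
    filter_upwards [hω _] with ω hω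
    exact ofReal_eq_transition_add hlam hν hδ (backlog_nonneg hω _ _)
  have hq_succ : ∀ k, q k = q (k + 1) + 2 * δ * e k := by
    intro k
    have hm : Measurable fun ω : Input => ENNReal.ofReal (backlog ω (k + i) i) :=
      (hbm _).ennreal_ofReal
    simp only [he, hq]
    rw [hkey, lintegral_present_succ hlam hG (by omega) c
      (g := fun x => ENNReal.ofReal x ^ 2 + κ * ENNReal.ofReal x)
      (by fun_prop), ← lintegral_const_mul _ hm, ← lintegral_add_right _ (hm.const_mul _)]
    refine lintegral_congr_ae ?_
    filter_upwards [hω _] with ω hω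
    exact sq_add_eq_transition_add hlam hν hδ hκ (backlog_nonneg hω _ _)
  have hd_succ : ∀ k, d k = d (k + 1) + s k := by
    intro k
    have hm : Measurable fun ω : Input => ENNReal.ofReal (served ω (k + i) i) :=
      (measurable_served _ i).ennreal_ofReal
    simp only [hd, hs]
    rw [hkey, ← lintegral_indicator (measurableSet_present _ _ _),
      ← lintegral_indicator (measurableSet_present _ _ _),
      ← lintegral_indicator (measurableSet_present _ _ _),
      ← lintegral_add_right _ (hm.indicator (measurableSet_present _ _ _))]
    refine lintegral_congr_ae ?_
    filter_upwards [ae_inputLaw hlam hG] with ω hω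
    have hiff : ω ∈ present i c (k + i + 1)
        ↔ ω ∈ present i c (k + i) ∧ gap ω (k + i) < backlog ω (k + i) i := by
      change _ ∧ _ ↔ (_ ∧ _) ∧ _
      rw [inSystem_succ (by omega), and_assoc]
    by_cases h : ω ∈ present i c (k + i)
    · rw [Set.indicator_of_mem h, Set.indicator_of_mem h]
      by_cases h' : gap ω (k + i) < backlog ω (k + i) i
      · rw [Set.indicator_of_mem (hiff.mpr ⟨h, h'⟩), ← ENNReal.ofReal_add
          (residual_nonneg hω _ _) (served_nonneg hω _ _), residual_succ_of_ne (by omega), served]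
        congr 1
        ring
      · rw [Set.indicator_of_notMem fun h'' => h' (hiff.mp h'').2,
          served_eq_residual (not_lt.mp h') (residual_nonneg hω _ _), zero_add]
    · rw [Set.indicator_of_notMem h, Set.indicator_of_notMem h,
        Set.indicator_of_notMem fun h'' => h (hiff.mp h'').1, zero_add]
  have hws : ∀ k, w k + s k = ENNReal.ofReal (1 / lam) * z k := by
    intro k
    have hm : Measurable fun ω : Input => ENNReal.ofReal (served ω (k + i) i) :=
      (measurable_served _ i).ennreal_ofReal
    have hmz : Measurable fun ω : Input => overshoot lam 0 (backlog ω (k + i) i) :=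
      (measurable_overshoot hlam 0).comp (hbm _)
    have hres := lintegral_present_resample_gap (G := G) (φ := φ) hlam (n := k + i)
      (Nat.le_add_left i k) c (f := fun r a => ENNReal.ofReal (min a r))
      (by unfold Function.uncurry; fun_prop)
    simp only [hw, hs, hz]
    rw [← lintegral_add_right _ hm, ← lintegral_const_mul _ hmz]
    refine Eq.trans (lintegral_congr_ae ?_) (hres.trans (lintegral_congr_ae ?_))
    · filter_upwards [hω _] with ω hω
      rw [min_gap_backlog hω, ENNReal.ofReal_add (le_min (hω _).1 (ahead_nonneg hω _ _))
        (served_nonneg hω _ _)]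
    · filter_upwards [hω _] with ω hω
      exact lintegral_min_expMeasure hlam (backlog_nonneg hω _ _)
  have hq0 : q 0 ≠ ∞ := by
    have hmb : Measurable fun ω : Input => ENNReal.ofReal (backlog ω (0 + i) i) :=
      (hbm _).ennreal_ofReal
    have hsq : ∫⁻ ω, ENNReal.ofReal (backlog ω (0 + i) i) ^ 2 ∂(inputLaw lam G φ) ≠ ∞ := by
      rwa [zero_add]
    have h1 : ∫⁻ ω, ENNReal.ofReal (backlog ω (0 + i) i) ∂(inputLaw lam G φ) ≠ ∞ := by
      refine ne_top_of_le_ne_top (ENNReal.add_ne_top.mpr ⟨hsq, ENNReal.one_ne_top⟩) ?_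
      have := Measure.isProbabilityMeasure_map (μ := inputLaw lam G φ) (hbm (0 + i)).aemeasurable
      have := powMoment_one_le (ν := (inputLaw lam G φ).map fun ω => backlog ω (0 + i) i)
      rw [powMoment, powMoment, lintegral_map (by fun_prop) (hbm _),
        lintegral_map (by fun_prop) (hbm _)] at this
      simpa using this
    refine ne_top_of_le_ne_top ?_ (setLIntegral_le_lintegral _ _)
    rw [lintegral_add_left (hmb.pow_const 2), lintegral_const_mul _ hmb]
    finiteness
  have he_lim : Tendsto e atTop (𝓝 0) := by
    -- The sum of `2 * δ * e k` is at most `q 0 < ∞`, so the mean backlogs tend to zero and the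
    -- telescoping sums for `e` and `d` have no remainder.
    have h := ne_top_of_le_ne_top hq0 (tsum_le_of_succ hq_succ)
    rw [ENNReal.tsum_mul_left] at h
    refine ENNReal.tendsto_atTop_zero_of_tsum_ne_top fun htop => h ?_
    rw [htop, ENNReal.mul_top (by simp [hδ0])]
  have hd_lim : Tendsto d atTop (𝓝 0) := by
    refine tendsto_of_tendsto_of_tendsto_of_le_of_le tendsto_const_nhds he_lim
      (fun k => zero_le) fun k => lintegral_mono_ae ?_
    filter_upwards [hω _] with ω hω
    refine ENNReal.ofReal_le_ofReal ?_
    rw [backlog]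
    linarith [ahead_nonneg hω (k + i) i]
  have he0 := eq_tsum_of_succ he_succ he_lim
  have hd0 := eq_tsum_of_succ hd_succ hd_lim
  simp only [he, hd, zero_add, present_self, residual_self] at he0 hd0
  rw [lintegral_wait, hd0, he0, ENNReal.tsum_mul_left, ← ENNReal.tsum_add]
  change δ * ∑' k, (w k + s k) = _
  simp only [hws]
  rw [ENNReal.tsum_mul_left]
  ring

end

/-! ### Mean waiting time by class -/

section

variable {lam : ℝ} {G : Measure ℝ} {φ : I}

/-- Probability that a customer is of class `c`. -/
def classProb (φ : I) (c : Bool) : ℝ := if c = true then φ else 1 - φ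

lemma classProb_nonneg (φ : I) (c : Bool) : 0 ≤ classProb φ c := by
  rw [classProb]
  split_ifs
  exacts [φ.2.1, sub_nonneg.mpr φ.2.2]

lemma lintegral_markLaw [IsProbabilityMeasure G] {F : ℝ × Bool → ℝ≥0∞} (hF : Measurable F) :
    ∫⁻ y, F y ∂(markLaw G φ)
      = ENNReal.ofReal φ * ∫⁻ s, F (s, true) ∂G
        + ENNReal.ofReal (1 - φ) * ∫⁻ s, F (s, false) ∂G := by
  have h1 : ((toNNReal φ : NNReal) : ℝ≥0∞) = ENNReal.ofReal φ := by
    rw [← ENNReal.ofReal_coe_nnreal]; rfl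
  have h2 : ((toNNReal (σ φ) : NNReal) : ℝ≥0∞) = ENNReal.ofReal (1 - φ) := by
    rw [← ENNReal.ofReal_coe_nnreal]; rfl
  have e : ∀ s, ∫⁻ c, F (s, c) ∂(bernoulliMeasure true false φ)
      = ENNReal.ofReal φ * F (s, true) + ENNReal.ofReal (1 - φ) * F (s, false) := by
    intro s
    rw [bernoulliMeasure_def, lintegral_add_measure, lintegral_smul_measure,
      lintegral_smul_measure, lintegral_dirac, lintegral_dirac, ← h1, ← h2]
    rfl
  rw [lintegral_prod _ hF.aemeasurable]
  simp only [e]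
  rw [lintegral_add_left (by fun_prop), lintegral_const_mul _ (by fun_prop),
    lintegral_const_mul _ (by fun_prop)]

lemma ofReal_add_ofReal_one_sub (φ : I) :
    ENNReal.ofReal φ + ENNReal.ofReal (1 - φ) = 1 := by
  rw [← ENNReal.ofReal_add φ.2.1 (sub_nonneg.mpr φ.2.2), add_sub_cancel, ENNReal.ofReal_one]

lemma powMoment_loadLaw_false [IsProbabilityMeasure G] (k : ℕ) :
    powMoment (loadLaw G φ false) k = powMoment G k := by
  have hm := measurable_load false
  rw [powMoment, loadLaw, lintegral_map (by fun_prop) hm, lintegral_markLaw (by fun_prop)]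
  simp only [load, true_or, if_true]
  rw [← add_mul, ofReal_add_ofReal_one_sub, one_mul]
  rfl

/-- The exponent must be positive: ordinary customers bring load `0`, and `0 ^ 0 = 1`. -/
lemma powMoment_loadLaw_true [IsProbabilityMeasure G] (k : ℕ) :
    powMoment (loadLaw G φ true) (k + 1) = ENNReal.ofReal φ * powMoment G (k + 1) := by
  have hm := measurable_load true
  rw [powMoment, loadLaw, lintegral_map (by fun_prop) hm, lintegral_markLaw (by fun_prop)]
  simp [load, powMoment]

lemma powMoment_overtakeLaw_false [IsProbabilityMeasure G] (k : ℕ) :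
    powMoment (overtakeLaw G φ false) (k + 1) = ENNReal.ofReal φ * powMoment G (k + 1) := by
  have hm := measurable_overtake false
  rw [powMoment, overtakeLaw, lintegral_map (by fun_prop) hm, lintegral_markLaw (by fun_prop)]
  simp [overtake, powMoment]

lemma powMoment_overtakeLaw_true [IsProbabilityMeasure G] (k : ℕ) :
    powMoment (overtakeLaw G φ true) (k + 1) = 0 := by
  have hm := measurable_overtake true
  rw [powMoment, overtakeLaw, lintegral_map (by fun_prop) hm, lintegral_markLaw (by fun_prop)]
  simp [overtake]

/-- The class, the service and everything that ignores coordinate `i` are independent, so the class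
contributes only its probability. -/
lemma lintegral_class (hlam : 0 < lam) [IsProbabilityMeasure G] (i : ℕ) (c : Bool)
    {f : Input → ℝ → ℝ≥0∞} (hf : Measurable (Function.uncurry f))
    (hfi : ∀ ω x, f (Function.update ω i x) = f ω) :
    ∫⁻ ω in {ω | premium ω i = c}, f ω (service ω i) ∂(inputLaw lam G φ)
      = ENNReal.ofReal (classProb φ c) * ∫⁻ ω, ∫⁻ s, f ω s ∂G ∂(inputLaw lam G φ) := by
  have hm : Measurable fun ω : Input => f ω (service ω i) :=
    hf.comp (measurable_id.prodMk (measurable_service i))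
  have hfω : ∀ ω, Measurable (f ω) := fun ω => hf.comp measurable_prodMk_left
  have hfint : Measurable fun ω : Input => ∫⁻ s, f ω s ∂G := hf.lintegral_prod_right'
  have hset := measurableSet_premium_eq i c
  rw [← lintegral_indicator hset, lintegral_resample_mark hlam i (hm.indicator hset),
    ← lintegral_const_mul _ hfint]
  refine lintegral_congr fun ω => ?_
  have e : ∀ y : ℝ × Bool, Set.indicator {ω : Input | premium ω i = c}
      (fun ω => f ω (service ω i)) (Function.update ω i ((ω i).1, y))
      = if y.2 = c then f ω y.1 else 0 := by
    intro y
    have hp : premium (Function.update ω i ((ω i).1, y)) i = y.2 := by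
      simp [premium]
    by_cases h : y.2 = c
    · rw [Set.indicator_of_mem (by exact hp.trans h), if_pos h, hfi, service, Function.update_self]
    · have hnot : Function.update ω i ((ω i).1, y) ∉ {ω : Input | premium ω i = c} :=
        fun h' => h (hp.symm.trans h')
      rw [Set.indicator_of_notMem hnot, if_neg h]
  have hFm : Measurable fun y : ℝ × Bool => if y.2 = c then f ω y.1 else 0 :=
    Measurable.ite (measurable_snd (measurableSet_singleton c))
      ((hfω ω).comp measurable_fst) measurable_const
  simp only [e]
  rw [lintegral_markLaw hFm]
  cases c <;> simp [classProb]

lemma lintegral_class_service (hlam : 0 < lam) [IsProbabilityMeasure G] (i : ℕ) (c : Bool) :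
    ∫⁻ ω in {ω | premium ω i = c}, ENNReal.ofReal (service ω i) ∂(inputLaw lam G φ)
      = ENNReal.ofReal (classProb φ c) * powMoment G 1 := by
  have := isProbabilityMeasure_inputLaw (G := G) (φ := φ) hlam
  rw [lintegral_class hlam i c (f := fun _ s => ENNReal.ofReal s)
    (by unfold Function.uncurry; fun_prop) fun _ _ => rfl]
  simp [powMoment]

lemma lintegral_class_backlog (hlam : 0 < lam) [IsProbabilityMeasure G] (hG : ∀ᵐ s ∂G, 0 ≤ s)
    (i : ℕ) (c : Bool) :
    ∫⁻ ω in {ω | premium ω i = c}, ENNReal.ofReal (backlog ω i i) ∂(inputLaw lam G φ)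
      = ENNReal.ofReal (classProb φ c)
        * (powMoment (lindleyLaw lam (loadLaw G φ c) i) 1 + powMoment G 1) := by
  have := isProbabilityMeasure_inputLaw (G := G) (φ := φ) hlam
  have hfd := measurable_found c i
  have h := lintegral_class (φ := φ) hlam i c
    (f := fun ω s => ENNReal.ofReal (found ω c i) + ENNReal.ofReal s) (G := G)
    (by unfold Function.uncurry; fun_prop) fun ω x => by simp only [found_update_self]
  have e : ∀ ω : Input, ∫⁻ s, (ENNReal.ofReal (found ω c i) + ENNReal.ofReal s) ∂G
      = ENNReal.ofReal (found ω c i) + powMoment G 1 := by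
    intro ω
    rw [lintegral_add_left measurable_const, lintegral_const, measure_univ, mul_one]
    simp [powMoment]
  have e' : ∫⁻ ω, (ENNReal.ofReal (found ω c i) + powMoment G 1) ∂(inputLaw lam G φ)
      = ∫⁻ ω, ENNReal.ofReal (found ω c i) ∂(inputLaw lam G φ) + powMoment G 1 := by
    rw [lintegral_add_left (by fun_prop), lintegral_const, measure_univ, mul_one]
  simp only [e] at h
  rw [e', lintegral_found hlam c i (g := fun x => ENNReal.ofReal x) (by fun_prop)] at h
  have e2 : powMoment (lindleyLaw lam (loadLaw G φ c) i) 1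
      = ∫⁻ x, ENNReal.ofReal x ∂(lindleyLaw lam (loadLaw G φ c) i) := by simp [powMoment]
  rw [e2, ← h]
  refine lintegral_congr_ae ?_
  filter_upwards [ae_restrict_of_ae (ae_inputLaw hlam hG),
    ae_restrict_mem (measurableSet_premium_eq i c)] with ω hω hc
  have hc' : premium ω i = c := hc
  have ha := ahead_nonneg hω i i
  rw [backlog, residual_self, ENNReal.ofReal_add ha (hω i).2, ahead_self hω, hc']

lemma ennreal_add_sq_le (x y : ℝ≥0∞) : (x + y) ^ 2 ≤ 4 * (x ^ 2 + y ^ 2) := by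
  have key : ∀ {x y : ℝ≥0∞}, x ≤ y → (x + y) ^ 2 ≤ 4 * (x ^ 2 + y ^ 2) := by
    intro x y h
    calc (x + y) ^ 2 ≤ (y + y) ^ 2 := by gcongr
      _ = 4 * y ^ 2 := by ring
      _ ≤ 4 * (x ^ 2 + y ^ 2) := by gcongr; exact le_add_self
  rcases le_total x y with h | h
  · exact key h
  · rw [add_comm x, add_comm (x ^ 2)]
    exact key h

lemma lintegral_backlog_sq_ne_top (hlam : 0 < lam) [IsProbabilityMeasure G]
    (hG : ∀ᵐ s ∂G, 0 ≤ s) (h2 : powMoment G 2 ≠ ∞) (i : ℕ) :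
    ∫⁻ ω, ENNReal.ofReal (backlog ω i i) ^ 2 ∂(inputLaw lam G φ) ≠ ∞ := by
  have := isProbabilityMeasure_inputLaw (G := G) (φ := φ) hlam
  have hclass : ∀ c, ∫⁻ ω in {ω | premium ω i = c}, ENNReal.ofReal (backlog ω i i) ^ 2
      ∂(inputLaw lam G φ) ≠ ∞ := by
    intro c
    have := isProbabilityMeasure_loadLaw (G := G) (φ := φ) c
    have hl2 : powMoment (loadLaw G φ c) 2 ≠ ∞ := by
      cases c
      · rwa [powMoment_loadLaw_false]
      · rw [powMoment_loadLaw_true]; finiteness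
    have hD := powMoment_lindleyLaw_two_ne_top hlam (ae_nonneg_loadLaw hG c) hl2 i
    have hfd := measurable_found c i
    have h := lintegral_class (φ := φ) hlam i c
      (f := fun ω s => 4 * (ENNReal.ofReal (found ω c i) ^ 2 + ENNReal.ofReal s ^ 2)) (G := G)
      (by unfold Function.uncurry; fun_prop) fun ω x => by simp only [found_update_self]
    have e : ∀ ω : Input, ∫⁻ s, 4 * (ENNReal.ofReal (found ω c i) ^ 2 + ENNReal.ofReal s ^ 2) ∂G
        = 4 * (ENNReal.ofReal (found ω c i) ^ 2 + powMoment G 2) := by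
      intro ω
      rw [lintegral_const_mul _ (by fun_prop), lintegral_add_left measurable_const,
        lintegral_const, measure_univ, mul_one, powMoment]
    have e' : ∫⁻ ω, 4 * (ENNReal.ofReal (found ω c i) ^ 2 + powMoment G 2) ∂(inputLaw lam G φ)
        = 4 * (∫⁻ ω, ENNReal.ofReal (found ω c i) ^ 2 ∂(inputLaw lam G φ) + powMoment G 2) := by
      rw [lintegral_const_mul _ (by fun_prop), lintegral_add_left (by fun_prop), lintegral_const,
        measure_univ, mul_one]
    simp only [e] at h
    rw [e', lintegral_found hlam c i (g := fun x => ENNReal.ofReal x ^ 2) (by fun_prop)] at h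
    refine ne_top_of_le_ne_top (b := ENNReal.ofReal (classProb φ c)
      * (4 * (powMoment (lindleyLaw lam (loadLaw G φ c) i) 2 + powMoment G 2)))
      (by finiteness) ?_
    refine le_of_le_of_eq (lintegral_mono_ae ?_) h
    filter_upwards [ae_restrict_of_ae (ae_inputLaw hlam hG),
      ae_restrict_mem (measurableSet_premium_eq i c)] with ω hω hc
    have hc' : premium ω i = c := hc
    have ha := ahead_nonneg hω i i
    rw [backlog, residual_self, ENNReal.ofReal_add ha (hω i).2, ahead_self hω, hc']
    exact ennreal_add_sq_le _ _
  rw [← lintegral_add_compl _ (measurableSet_premium_eq i true)]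
  have hcompl : {ω : Input | premium ω i = true}ᶜ = {ω | premium ω i = false} := by
    ext ω
    simp
  rw [hcompl]
  exact ENNReal.add_ne_top.mpr ⟨hclass true, hclass false⟩

lemma expectedWait_eq_add (i : ℕ) :
    expectedWait lam G φ i
      = ∫⁻ ω in {ω | premium ω i = true}, wait ω i ∂(inputLaw lam G φ)
        + ∫⁻ ω in {ω | premium ω i = false}, wait ω i ∂(inputLaw lam G φ) := by
  have hcompl : {ω : Input | premium ω i = true}ᶜ = {ω | premium ω i = false} := by
    ext ω
    simp
  rw [expectedWait, ← lintegral_add_compl _ (measurableSet_premium_eq i true), hcompl]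

/-- Mean waiting time of the `i`-th customer on the event that he is of class `c`, in terms of the
mean work he finds ahead of him and the rate `b` at which he is overtaken. -/
lemma lintegral_class_wait (hlam : 0 < lam) [IsProbabilityMeasure G] (hG : ∀ᵐ s ∂G, 0 ≤ s)
    (h2 : powMoment G 2 ≠ ∞) {s₁ b : ℝ} (hs₁ : powMoment G 1 = ENNReal.ofReal s₁) (hs₁0 : 0 ≤ s₁)
    (i : ℕ) (c : Bool) (hb : powMoment (overtakeLaw G φ c) 1 = ENNReal.ofReal b) (hb0 : 0 ≤ b)
    (hst : lam * b < 1) :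
    ∫⁻ ω in {ω | premium ω i = c}, wait ω i ∂(inputLaw lam G φ)
      = ENNReal.ofReal (classProb φ c
        * (((powMoment (lindleyLaw lam (loadLaw G φ c) i) 1).toReal + s₁) / (1 - lam * b) - s₁)) := by
  have := isProbabilityMeasure_loadLaw (G := G) (φ := φ) c
  have hl2 : powMoment (loadLaw G φ c) 2 ≠ ∞ := by
    cases c
    · rwa [powMoment_loadLaw_false]
    · rw [powMoment_loadLaw_true]; finiteness
  have ho2 : powMoment (overtakeLaw G φ c) 2 ≠ ∞ := by
    cases c
    · rw [powMoment_overtakeLaw_false]; finiteness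
    · rw [powMoment_overtakeLaw_true]; finiteness
  have hD := powMoment_lindleyLaw_one_ne_top hlam (ae_nonneg_loadLaw hG c) hl2 i
  have hd : 0 < 1 / lam - b := by
    rw [sub_pos, lt_div_iff₀ hlam]
    linarith
  have hδ : ENNReal.ofReal (1 / lam)
      = powMoment (overtakeLaw G φ c) 1 + ENNReal.ofReal (1 / lam - b) := by
    rw [hb, ← ENNReal.ofReal_add hb0 hd.le, add_sub_cancel]
  have hbal := wait_balance hlam hG i c ho2 (by simpa using hd) hδ
    (lintegral_backlog_sq_ne_top hlam hG h2 i)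
  rw [lintegral_class_service hlam, lintegral_class_backlog hlam hG] at hbal
  set m := (powMoment (lindleyLaw lam (loadLaw G φ c) i) 1).toReal with hm
  have hm0 : 0 ≤ m := ENNReal.toReal_nonneg
  rw [← ENNReal.ofReal_toReal hD, ← hm, hs₁] at hbal
  have hπ := classProb_nonneg φ c
  have hpos : 0 < 1 - lam * b := by linarith
  have hx0 : 0 ≤ classProb φ c * ((m + s₁) / (1 - lam * b) - s₁) := by
    refine mul_nonneg hπ (sub_nonneg.mpr ?_)
    rw [le_div_iff₀ hpos]
    nlinarith [mul_nonneg hlam.le hb0]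
  have hx : ENNReal.ofReal (1 / lam - b)
      * (ENNReal.ofReal (classProb φ c * ((m + s₁) / (1 - lam * b) - s₁))
        + ENNReal.ofReal (classProb φ c) * ENNReal.ofReal s₁)
      = ENNReal.ofReal (1 / lam)
        * (ENNReal.ofReal (classProb φ c) * (ENNReal.ofReal m + ENNReal.ofReal s₁)) := by
    rw [← ENNReal.ofReal_mul hπ, ← ENNReal.ofReal_add hx0 (by positivity),
      ← ENNReal.ofReal_mul hd.le, ← ENNReal.ofReal_add hm0 hs₁0, ← ENNReal.ofReal_mul hπ,
      ← ENNReal.ofReal_mul (by positivity)]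
    congr 1
    field_simp
    ring
  rw [← hx, ENNReal.mul_right_inj (by simpa using hd) ENNReal.ofReal_ne_top,
    ENNReal.add_left_inj (by finiteness)] at hbal
  exact hbal

end

/-! ### The limit formula and the optimization over states -/

section

variable {lam mu rho K : ℝ} {G : Measure ℝ}

/-- Stationary mean waiting time in state `x`. -/
noncomputable def stationaryWait (mu rho K x : ℝ) : ℝ :=
  rho * (K - 2 * x * rho + (2 - K) * x * (1 - x * (1 - rho)))
    / (2 * mu * (1 - rho) * (1 - x * rho))

lemma powMoment_eq_ofReal (hG : ∀ᵐ s ∂G, 0 ≤ s) (k : ℕ)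
    (hint : Integrable (fun s : ℝ => s ^ k) G) :
    powMoment G k = ENNReal.ofReal (∫ s, s ^ k ∂G) := by
  rw [ofReal_integral_eq_lintegral_ofReal hint (hG.mono fun s hs => pow_nonneg hs k), powMoment]
  refine lintegral_congr_ae (hG.mono fun s hs => ?_)
  exact (ENNReal.ofReal_pow hs k).symm

theorem tendsto_expectedWait (hlam : 0 < lam) (hmu : 0 < mu) (hrho : rho = lam / mu)
    (hstable : rho < 1) [IsProbabilityMeasure G] (hG : ∀ᵐ s ∂G, 0 ≤ s)
    (hG_int : Integrable (fun s : ℝ => s ^ 2) G) (hG_mean : ∫ s, s ∂G = 1 / mu)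
    (hG_second : ∫ s, s ^ 2 ∂G = K / mu ^ 2) (φ : I) :
    Tendsto (expectedWait lam G φ) atTop (𝓝 (ENNReal.ofReal (stationaryWait mu rho K φ))) := by
  have hφ0 : 0 ≤ (φ : ℝ) := φ.2.1
  have hφ1 : (φ : ℝ) ≤ 1 := φ.2.2
  have hrho0 : 0 < rho := hrho ▸ div_pos hlam hmu
  have hφρ : (φ : ℝ) * rho < 1 := by nlinarith
  have hint1 : Integrable (fun s : ℝ => s ^ 1) G := by
    simp only [pow_one]
    -- The Bochner integral of a non-integrable function is `0`, which contradicts the mean `1 / mu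
    -- > 0`.
    by_contra h
    rw [integral_undef h] at hG_mean
    exact (one_div_pos.mpr hmu).ne hG_mean
  have hM1 : powMoment G 1 = ENNReal.ofReal (1 / mu) := by
    rw [powMoment_eq_ofReal hG 1 hint1, ← hG_mean]
    simp only [pow_one]
  have hM2 : powMoment G 2 = ENNReal.ofReal (K / mu ^ 2) := by
    rw [powMoment_eq_ofReal hG 2 hG_int, hG_second]
  have hK : 0 ≤ K / mu ^ 2 := hG_second ▸ integral_nonneg fun s => sq_nonneg s
  have hM2t : powMoment G 2 ≠ ∞ := hM2 ▸ ENNReal.ofReal_ne_top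
  have hmu' : 0 ≤ 1 / mu := by positivity
  have hst : lam * (1 / mu) = rho := by rw [hrho]; ring
  have hstφ : lam * (φ * (1 / mu)) = φ * rho := by rw [hrho]; ring
  have := isProbabilityMeasure_loadLaw (G := G) (φ := φ) true
  have := isProbabilityMeasure_loadLaw (G := G) (φ := φ) false
  have hl2t : powMoment (loadLaw G φ true) 2 = ENNReal.ofReal (φ * (K / mu ^ 2)) := by
    rw [powMoment_loadLaw_true, hM2, ENNReal.ofReal_mul hφ0]
  have hl1t : powMoment (loadLaw G φ true) 1 = ENNReal.ofReal (φ * (1 / mu)) := by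
    rw [powMoment_loadLaw_true, hM1, ENNReal.ofReal_mul hφ0]
  have hl2f : powMoment (loadLaw G φ false) 2 = ENNReal.ofReal (K / mu ^ 2) := by
    rw [powMoment_loadLaw_false, hM2]
  have hl1f : powMoment (loadLaw G φ false) 1 = ENNReal.ofReal (1 / mu) := by
    rw [powMoment_loadLaw_false, hM1]
  have limt := tendsto_powMoment_lindleyLaw hlam (ae_nonneg_loadLaw (φ := φ) hG true)
    (by rw [hl2t]; finiteness)
    (by rw [hl1t, ENNReal.toReal_ofReal (by positivity), hstφ]; exact hφρ)
  have limf := tendsto_powMoment_lindleyLaw hlam (ae_nonneg_loadLaw (φ := φ) hG false)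
    (by rw [hl2f]; finiteness)
    (by rw [hl1f, ENNReal.toReal_ofReal hmu', hst]; exact hstable)
  rw [hl1t, hl2t, ENNReal.toReal_ofReal (by positivity), ENNReal.toReal_ofReal (by positivity),
    hstφ] at limt
  rw [hl1f, hl2f, ENNReal.toReal_ofReal hK, ENNReal.toReal_ofReal hmu', hst] at limf
  -- Premium customers are never overtaken (`b = 0`); ordinary ones are overtaken by premium work of
  -- mean `φ / mu` per arrival.
  have hwt := fun i => lintegral_class_wait (φ := φ) hlam hG hM2t hM1 hmu' i true (b := 0)
    (by rw [powMoment_overtakeLaw_true, ENNReal.ofReal_zero]) le_rfl (by simp)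
  have hwf := fun i => lintegral_class_wait (φ := φ) hlam hG hM2t hM1 hmu' i false
    (b := φ * (1 / mu)) (by rw [powMoment_overtakeLaw_false, hM1, ENNReal.ofReal_mul hφ0])
    (by positivity) (by rw [hstφ]; exact hφρ)
  have hval : stationaryWait mu rho K φ
      = classProb φ true * ((lam * (φ * (K / mu ^ 2)) / (2 * (1 - φ * rho)) + 1 / mu)
          / (1 - lam * 0) - 1 / mu)
        + classProb φ false * ((lam * (K / mu ^ 2) / (2 * (1 - rho)) + 1 / mu)
          / (1 - lam * (φ * (1 / mu))) - 1 / mu) := by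
    have h1 : 1 - rho ≠ 0 := by linarith
    have h2 : 1 - φ * rho ≠ 0 := by linarith
    have h3 : 1 - rho * φ ≠ 0 := by linarith
    have hl : lam = rho * mu := by rw [hrho]; field_simp
    rw [hstφ, hl]
    simp only [classProb, stationaryWait, if_true, Bool.false_eq_true, if_false]
    field_simp
    ring
  have hlimt := ((limt.add_const (1 / mu)).div_const (1 - lam * 0)).sub_const (1 / mu)
    |>.const_mul (classProb φ true)
  have hlimf := ((limf.add_const (1 / mu)).div_const (1 - lam * (φ * (1 / mu)))).sub_const (1 / mu)
    |>.const_mul (classProb φ false)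
  have hnn : 0 ≤ classProb φ true * ((lam * (φ * (K / mu ^ 2)) / (2 * (1 - φ * rho)) + 1 / mu)
      / (1 - lam * 0) - 1 / mu) := by
    have : 0 < 1 - φ * rho := by linarith
    refine mul_nonneg (classProb_nonneg _ _) ?_
    rw [mul_zero, sub_zero, div_one, add_sub_cancel_right]
    positivity
  have hnn' : 0 ≤ classProb φ false * ((lam * (K / mu ^ 2) / (2 * (1 - rho)) + 1 / mu)
      / (1 - lam * (φ * (1 / mu))) - 1 / mu) := by
    have h1 : 0 < 1 - φ * rho := by linarith
    have h2 : 0 < 1 - rho := by linarith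
    refine mul_nonneg (classProb_nonneg _ _) (sub_nonneg.mpr ?_)
    rw [hstφ, le_div_iff₀ h1]
    have h3 : 0 ≤ lam * (K / mu ^ 2) / (2 * (1 - rho)) := by positivity
    nlinarith [mul_nonneg hmu' (mul_nonneg hφ0 hrho0.le)]
  rw [hval, ENNReal.ofReal_add hnn hnn']
  refine ((ENNReal.tendsto_ofReal hlimt).add (ENNReal.tendsto_ofReal hlimf)).congr fun i => ?_
  rw [expectedWait_eq_add, hwt, hwf]

/-- The mean waiting time as a function of the excess over `x = 0`. -/
lemma stationaryWait_eq (hmu : 0 < mu) (hrho : rho < 1) {x : ℝ} (hx : x * rho < 1) :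
    stationaryWait mu rho K x
      = rho / (2 * mu * (1 - rho)) * (K + (2 - K) * ((1 - rho) * (x * (1 - x) / (1 - x * rho)))) := by
  have h1 : 1 - rho ≠ 0 := by linarith
  have h2 : 1 - x * rho ≠ 0 := by linarith
  have h3 : 1 - rho * x ≠ 0 := by linarith
  rw [stationaryWait]
  field_simp
  ring

/-- With `s = √(1 - rho)` one has `rho = (1 - s)(1 + s)`, so `φ* = 1 / (1 + s)` and `1 + rho φ*² = 2
φ*`. The numerator `φ*² (1 - x rho) - x (1 - x)` is then the square of `x - φ*`. -/
lemma mul_one_sub_div_le (h0 : 0 < rho) (h1 : rho < 1) {x : ℝ} (hx : x * rho < 1) :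
    1 / (1 + √(1 - rho)) ^ 2 - x * (1 - x) / (1 - x * rho)
      = (x - (1 - √(1 - rho)) / rho) ^ 2 / (1 - x * rho) := by
  have hs2 : √(1 - rho) ^ 2 = 1 - rho := Real.sq_sqrt (by linarith)
  have hs : 0 < √(1 - rho) := Real.sqrt_pos.mpr (by linarith)
  set s := √(1 - rho) with hsd
  have hr : rho = (1 - s) * (1 + s) := by linarith
  have hx' : 1 - x * rho ≠ 0 := by linarith
  have h1s : 1 - s ≠ 0 := fun h => h0.ne' (by rw [hr, h, zero_mul])
  have e : (1 - s) / rho = 1 / (1 + s) := by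
    rw [hr]; field_simp
  rw [e, eq_div_iff hx', sub_mul, div_mul_cancel₀ _ hx', hr]
  field_simp
  ring

lemma optimalPoint_mem (h0 : 0 < rho) (h1 : rho < 1) :
    (1 - √(1 - rho)) / rho ∈ Set.Icc (0 : ℝ) 1 := by
  have hs2 : √(1 - rho) ^ 2 = 1 - rho := Real.sq_sqrt (by linarith)
  have hs : 0 ≤ √(1 - rho) := Real.sqrt_nonneg _
  have hs1 : √(1 - rho) ≤ 1 := Real.sqrt_le_one.mpr (by linarith)
  refine ⟨div_nonneg (by linarith) h0.le, ?_⟩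
  rw [div_le_one h0]
  nlinarith

end

end PRQueue

open PRQueue in
theorem lemma2 (lam mu rho K : ℝ) (hlam : 0 < lam) (hmu : 0 < mu)
    (hrho : rho = lam / mu) (hstable : rho < 1)
    (G : Measure ℝ) [IsProbabilityMeasure G]
    (hG_nonneg : ∀ᵐ s ∂G, 0 ≤ s)
    (hG_int : Integrable (fun s : ℝ => s ^ 2) G)
    (hG_mean : ∫ s, s ∂G = 1 / mu)
    (hG_second : ∫ s, s ^ 2 ∂G = K / mu ^ 2) :
    (∀ φ : I, Tendsto (PRQueue.expectedWait lam G φ) atTop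
      (𝓝 (ENNReal.ofReal
        (rho * (K - 2 * φ * rho + (2 - K) * φ * (1 - φ * (1 - rho)))
          / (2 * mu * (1 - rho) * (1 - φ * rho)))))) ∧
    (K < 2 → PRQueue.optimalStates lam G = {0, 1}) ∧
    (K = 2 → PRQueue.optimalStates lam G = Set.Icc 0 1) ∧
    (2 < K → PRQueue.optimalStates lam G = {(1 - √(1 - rho)) / rho}) := by
  have hlim := tendsto_expectedWait hlam hmu hrho hstable hG_nonneg hG_int hG_mean hG_second
  have hmean : ∀ φ : I, meanWait lam G φ = ENNReal.ofReal (stationaryWait mu rho K φ) :=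
    fun φ => (hlim φ).limsup_eq
  have hrho0 : 0 < rho := hrho ▸ div_pos hlam hmu
  have hφρ : ∀ φ : I, (φ : ℝ) * rho < 1 := fun φ => by nlinarith [φ.2.1, φ.2.2]
  have hK : 0 ≤ K := by
    have h : 0 ≤ K / mu ^ 2 := hG_second ▸ integral_nonneg fun s => sq_nonneg s
    have := mul_nonneg h (sq_nonneg mu)
    rwa [div_mul_cancel₀ _ (by positivity)] at this
  set h : I → ℝ := fun φ => (1 - rho) * (φ * (1 - φ) / (1 - φ * rho)) with hh
  have hC : 0 < rho / (2 * mu * (1 - rho)) :=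
    div_pos hrho0 (mul_pos (by positivity) (by linarith))
  have hval : ∀ φ : I, stationaryWait mu rho K φ
      = rho / (2 * mu * (1 - rho)) * (K + (2 - K) * h φ) :=
    fun φ => stationaryWait_eq hmu hstable (hφρ φ)
  have hh0 : ∀ φ : I, 0 ≤ h φ := fun φ =>
    mul_nonneg (by linarith) (div_nonneg (mul_nonneg φ.2.1 (sub_nonneg.mpr φ.2.2))
      (by linarith [hφρ φ]))
  have hh1 : ∀ φ : I, h φ ≤ 1 := fun φ => by
    have hpos : 0 < 1 - (φ : ℝ) * rho := by linarith [hφρ φ]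
    rw [hh]
    dsimp only
    rw [← mul_div_assoc, div_le_one hpos]
    nlinarith [φ.2.1, φ.2.2, mul_nonneg φ.2.1 (sub_nonneg.mpr φ.2.2), sq_nonneg ((φ : ℝ) - 1),
      mul_nonneg (mul_nonneg φ.2.1 (sub_nonneg.mpr φ.2.2)) hrho0.le]
  have hle : ∀ φ ψ : I, meanWait lam G φ ≤ meanWait lam G ψ ↔ (2 - K) * h φ ≤ (2 - K) * h ψ := by
    intro φ ψ
    -- `ENNReal.ofReal` reflects the order only for a nonnegative right-hand side; here `K + (2 - K)
    -- h = K (1 - h) + 2 h` with `0 ≤ h ≤ 1`.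
    have hnn : 0 ≤ stationaryWait mu rho K ψ := by
      rw [hval]
      refine mul_nonneg hC.le ?_
      nlinarith [hh0 ψ, hh1 ψ, mul_nonneg hK (sub_nonneg.mpr (hh1 ψ))]
    rw [hmean, hmean, ENNReal.ofReal_le_ofReal_iff hnn, hval, hval, mul_le_mul_iff_right₀ hC]
    exact add_le_add_iff_left K
  refine ⟨hlim, fun hK2 => ?_, fun hK2 => ?_, fun hK2 => ?_⟩
  · have hle' : ∀ φ ψ : I, meanWait lam G φ ≤ meanWait lam G ψ ↔ h φ ≤ h ψ := fun φ ψ => by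
      rw [hle, mul_le_mul_iff_right₀ (by linarith)]
    ext x
    simp only [optimalStates, hle', Set.mem_insert_iff, Set.mem_singleton_iff]
    constructor
    · rintro ⟨φ, rfl, hφ⟩
      -- Comparison with the state `0`, where `h` vanishes, forces `h φ = 0`.
      have h0 := hφ 0
      have hpos : 0 < 1 - (φ : ℝ) * rho := by linarith [hφρ φ]
      have hz : h φ = 0 := le_antisymm (by simpa [hh] using h0) (hh0 φ)
      rcases mul_eq_zero.mp hz with h1 | h1
      · linarith
      · rcases div_eq_zero_iff.mp h1 with h2 | h2
        · rcases mul_eq_zero.mp h2 with h3 | h3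
          · exact Or.inl h3
          · exact Or.inr (by linarith)
        · linarith
    · rintro (rfl | rfl)
      · exact ⟨0, rfl, fun ψ => by simpa [hh] using hh0 ψ⟩
      · exact ⟨1, rfl, fun ψ => by simpa [hh] using hh0 ψ⟩
  · ext x
    simp only [optimalStates, hle, hK2, sub_self, zero_mul, le_refl, implies_true, and_true]
    exact ⟨fun ⟨φ, hφ⟩ => hφ ▸ φ.2, fun hx => ⟨⟨x, hx⟩, rfl⟩⟩
  · have hle' : ∀ φ ψ : I, meanWait lam G φ ≤ meanWait lam G ψ ↔ h ψ ≤ h φ := fun φ ψ => by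
      rw [hle, mul_le_mul_left_of_neg (by linarith)]
    have hgap : ∀ φ : I, (1 - rho) * (1 / (1 + √(1 - rho)) ^ 2) - h φ
        = (1 - rho) * (((φ : ℝ) - (1 - √(1 - rho)) / rho) ^ 2 / (1 - φ * rho)) := fun φ => by
      rw [← mul_one_sub_div_le hrho0 hstable (hφρ φ), mul_sub]
    -- Evaluated at `φ*`, the square vanishes, which identifies the constant in `hgap` as the
    -- maximum `h φ*`.
    have hopt := hgap ⟨_, optimalPoint_mem hrho0 hstable⟩
    simp only [sub_self, ne_eq, OfNat.ofNat_ne_zero, not_false_eq_true, zero_pow, zero_div,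
      mul_zero] at hopt
    ext x
    simp only [optimalStates, hle', Set.mem_singleton_iff]
    constructor
    · rintro ⟨φ, rfl, hφ⟩
      have h1 := hφ ⟨_, optimalPoint_mem hrho0 hstable⟩
      have hpos : 0 < 1 - (φ : ℝ) * rho := by linarith [hφρ φ]
      have h2 : (1 - rho) * (((φ : ℝ) - (1 - √(1 - rho)) / rho) ^ 2 / (1 - φ * rho)) ≤ 0 := by
        rw [← hgap φ]; linarith
      have h3 : ((φ : ℝ) - (1 - √(1 - rho)) / rho) ^ 2 ≤ 0 := by
        by_contra hc
        have := mul_pos (show 0 < 1 - rho by linarith) (div_pos (not_le.mp hc) hpos)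
        linarith
      exact sub_eq_zero.mp (pow_eq_zero_iff (two_ne_zero) |>.mp (le_antisymm h3 (sq_nonneg _)))
    · rintro rfl
      refine ⟨⟨_, optimalPoint_mem hrho0 hstable⟩, rfl, fun ψ => ?_⟩
      have hpos : 0 < 1 - (ψ : ℝ) * rho := by linarith [hφρ ψ]
      have h1 : 0 ≤ (1 - rho) * (((ψ : ℝ) - (1 - √(1 - rho)) / rho) ^ 2 / (1 - ψ * rho)) :=
        mul_nonneg (by linarith) (div_nonneg (sq_nonneg _) hpos.le)
      rw [← hgap ψ] at h1
      linarith
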